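/- **Setting.** Let $K$ be a linearly ordered set of keys and let any set of threads operate on a shared memory. Node keys are elements of $K\cup\{-\infty,+\infty\}$. A *vertex node* has fields `val`, `vnext`, `EdgeHead`, `EdgeTail`, `marked`, `lock`; an *edge node* has fields `val`, `enext`, `status` $\in\{\text{transit},\text{marked},\text{added}\}$, `lock`. Creating a vertex node with key $k$ gives it an empty sorted edge list $\mathrm{EdgeHead}(-\infty)\to\mathrm{EdgeTail}(+\infty)$ and `marked` $=$ false; the status of all these list sentinels is one fixed value $\sigma\in\{\text{transit},\text{added}\}$. A newly created edge node has status transit. `new` always returns an unused address, and nodes are never reused. Initially the vertex list is $\mathrm{VertexHead}(-\infty)\to\mathrm{VertexTail}(+\infty)$ and every thread is idle. A thread repeatedly calls one of the methods below, with arbitrary arguments from $K$. Every read or write of a mutable shared field, every creation of a node, and every lock acquisition or release is one atomic step, and the steps of the threads interleave arbitrarily. Acquiring a lock waits until it is free. * *LocateVertex*$(k)$: scan from $v_1=\mathrm{VertexHead}$, $v_2=v_1.\mathrm{vnext}$ to the first $v_2$ with key $\ge k$, without locks. Lock $v_1$, then $v_2$. Check that $v_1,v_2$ are unmarked and $v_1.\mathrm{vnext}=v_2$;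 on failure release both and start again. * *AddVertex*$(k)$: LocateVertex; if $v_2.\mathrm{val}\ne k$, create a vertex node $v_3$ with key $k$, set $v_3.\mathrm{vnext}:=v_2$, then $v_1.\mathrm{vnext}:=v_3$; release the locks. * *RemoveVertex*$(k)$: LocateVertex; if $v_2.\mathrm{val}=k$, set $v_2.\mathrm{marked}:=\mathrm{true}$, then $v_1.\mathrm{vnext}:=v_2.\mathrm{vnext}$; release the locks. * *ContainsVertex*$(k)$: scan the vertex list, without locks, to the first node with key $\ge k$; return whether its key is $k$ and it is unmarked. * *HelpSearchEdge*$(k_1,k_2)$: search the vertex list, without locks, for unmarked nodes $v_1,v_2$ with keys $k_1,k_2$, one after the other in either order, where the second scan starts at the successor of the first node found or at VertexHead; fail if one of them is not found. * *AcyclicLocateEdge*$(k_1,k_2)$: HelpSearchEdge; then fail if $v_1$ or $v_2$ is now marked. Then scan the edge list of $v_1$, without locks, from $e_1=v_1.\mathrm{EdgeHead}$, $e_2=e_1.\mathrm{enext}$ to the first $e_2$ with key $\ge k_2$; lock $e_1$, then $e_2$; validate. If validation fails, release both and repeat the scan. Validation checks $e_1.\mathrm{enext}=e_2$ and that both statuses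 are $\ne$ marked (for AcyclicAddEdge), respectively $=$ added (for AcyclicRemoveEdge). *NewLocateEdge* is this same loop on the node $v_1$ already known, with the validation of AcyclicAddEdge. * *AcyclicRemoveEdge*$(k_1,k_2)$: AcyclicLocateEdge; if it succeeds and $e_2.\mathrm{val}=k_2$, set $e_2.\mathrm{status}:=\text{marked}$, then $e_1.\mathrm{enext}:=e_2.\mathrm{enext}$; release the locks. * *AcyclicContainsEdge*$(k_1,k_2)$: HelpSearchEdge; if it succeeds, scan the edge list of $v_1$, without locks, to the first node with key $\ge k_2$; return whether its key is $k_2$ and its status is added. * *AcyclicAddEdge*$(k_1,k_2)$: AcyclicLocateEdge; on failure return false. If $e_2.\mathrm{val}=k_2$, release the locks and return true. Otherwise create an edge node $e_3$ with key $k_2$ (in transit), set $e_3.\mathrm{enext}:=e_2$, then $e_1.\mathrm{enext}:=e_3$, release the locks and run *PathExists*$(k_2,k_1)$. If that returns false, set $e_3.\mathrm{status}:=\text{added}$ and return true. If it returns true, run NewLocateEdge, which returns locked nodes $ne_1,ne_2$; set $e_3.\mathrm{status}:=\text{marked}$, then $ne_1.\mathrm{enext}:=ne_2.\mathrm{enext}$,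 release $ne_1,ne_2$ and return false. * *PathExists*$(a,b)$, without locks and with a local set $R$ of keys, initially empty: explore $a$, then repeatedly explore some unexplored key of $R$. Exploring $x$ means: scan the vertex list from VertexHead to the first node with key $\ge x$; if its key is $x$ and it is unmarked, walk along its edge list, up to but not including the last node, and add to $R$ the key of every node whose status is read as $\ne$ marked; if then $b\in R$, return true. Return false when every key in $R$ has been explored. In a global state, the *vertices* of the graph are the $u\in K$ for which an unmarked vertex node with key $u$ is reachable from VertexHead along `vnext`. A pair $(u,v)$ of vertices is an *added edge* if an edge node with key $v$ and status added is reachable, along `enext`, from the EdgeHead of an unmarked vertex node with key $u$ that is reachable from VertexHead. **Lemma.** In every execution of this algorithm, with arbitrary concurrent calls of all the methods, in every global state the added edges form no cycle: there is no vertex $u$ with a directed walk of positive length (loops included) of added edges from $u$ to $u$. -/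

import Mathlib

/-! # A concurrent adjacency-list graph with reachability-based cycle prevention

The shared memory, the program of every method (one constructor of `ThreadStep` per atomic
access to a mutable shared field), the interleaving semantics, and the abstract graph. -/

namespace ConcGraph

/-- Keys stored in nodes: the keys of `K` together with `⊥` (minus infinity, head sentinels) and
`⊤` (plus infinity, tail sentinels). -/
abbrev Key (K : Type*) := WithBot (WithTop K)

/-- The node key of an ordinary key. -/
def Key.of {K : Type*} (k : K) : Key K := ((k : WithTop K) : WithBot (WithTop K))

/-- Addresses of nodes; vertex nodes and edge nodes have separate address spaces. -/
abbrev Addr := ℕ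

inductive Status
  | transit
  | marked
  | added

/-- An edge node. `enext = none` is the null pointer; `lock = some t` if thread `t` holds it. -/
structure ENode (T K : Type*) where
  val : Key K
  enext : Option Addr
  status : Status
  lock : Option T

/-- A vertex node. -/
structure VNode (T K : Type*) where
  val : Key K
  vnext : Option Addr
  edgeHead : Addr
  edgeTail : Addr
  marked : Bool
  lock : Option T

/-- The shared memory; `none` means that the address is not allocated. -/
structure Mem (T K : Type*) where
  vnode : Addr → Option (VNode T K)
  enode : Addr → Option (ENode T K)

namespace Mem

variable {T K : Type*}

def setV (m : Mem T K) (a : Addr) (n : VNode T K) : Mem T K :=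
  { m with vnode := Function.update m.vnode a (some n) }

def setE (m : Mem T K) (a : Addr) (n : ENode T K) : Mem T K :=
  { m with enode := Function.update m.enode a (some n) }

/-- The effect of `new vnode(k)` at the vertex address `a`, with `h` and `l` the addresses of its two
edge sentinels, whose status is `σ`. -/
def newV (σ : Status) (m : Mem T K) (a h l : Addr) (k : Key K) : Mem T K :=
  ((m.setE l ⟨⊤, none, σ, none⟩).setE h ⟨⊥, some l, σ, none⟩).setV a ⟨k, none, h, l, false, none⟩

/-- The effect of `new enode(k)` at the address `a`. -/
def newE (m : Mem T K) (a : Addr) (k : Key K) : Mem T K :=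
  m.setE a ⟨k, none, .transit, none⟩

end Mem

/-- The fixed address of `VertexHead`. -/
def vertexHead : Addr := 0

/-- The fixed address of `VertexTail`. -/
def vertexTail : Addr := 1

/-- The initial memory: the vertex list `VertexHead, VertexTail`, both with empty edge lists. -/
def initMem (σ : Status) (T K : Type*) : Mem T K where
  vnode a :=
    if a = vertexHead then some ⟨⊥, some vertexTail, 0, 1, false, none⟩
    else if a = vertexTail then some ⟨⊤, none, 2, 3, false, none⟩
    else none
  enode a :=
    if a = 0 then some ⟨⊥, some 1, σ, none⟩
    else if a = 1 then some ⟨⊤, none, σ, none⟩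
    else if a = 2 then some ⟨⊥, some 3, σ, none⟩
    else if a = 3 then some ⟨⊤, none, σ, none⟩
    else none

/-- The methods that use the locking search of the vertex list. -/
inductive VOp
  | add
  | remove

/-- The methods on edges. -/
inductive EOp
  | add
  | remove
  | contains

/-- The three uses of the locking search of an edge list: by `AcyclicAddEdge` before the insertion,
by `AcyclicRemoveEdge`, and by `AcyclicAddEdge` when it takes its own edge node `e₃` out again. -/
inductive EMode
  | add
  | remove
  | undo (e₃ : Addr)

/-- The status that validation demands of both locked edge nodes: `added` for the removal of an
edge (`AcyclicValidateEdge`), anything but `marked` otherwise (`ModifiedValidateEdge`). -/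
def EMode.Valid : EMode → Status → Prop
  | .remove, s => s = .added
  | _, s => s ≠ .marked

/-- What an execution of `AcyclicAddEdge` keeps while it runs `PathExists(key₂, key₁)`: its two
keys, the vertex node `v₁` and its new edge node `e₃`. -/
structure AddCtx (K : Type*) where
  k₁ : Key K
  k₂ : Key K
  v₁ : Addr
  e₃ : Addr

/-- Program points of a thread, with the values of the live local variables. -/
inductive PC (K : Type*)
  /-- no method is being executed -/
  | idle
  /-- about to return `b` -/
  | ret (b : Bool)
  /- `ContainsVertex` -/
  | cvScan (k : Key K) (v : Addr)
  /- `LocateVertex`, `ValidateVertex` -/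
  | vlStart (op : VOp) (k : Key K)
  | vlScan (op : VOp) (k : Key K) (v₁ v₂ : Addr)
  | vlLock₁ (op : VOp) (k : Key K) (v₁ v₂ : Addr)
  | vlLock₂ (op : VOp) (k : Key K) (v₁ v₂ : Addr)
  | vlCheck₁ (op : VOp) (k : Key K) (v₁ v₂ : Addr)
  | vlCheck₂ (op : VOp) (k : Key K) (v₁ v₂ : Addr)
  | vlCheck₃ (op : VOp) (k : Key K) (v₁ v₂ : Addr)
  | vlFail₁ (op : VOp) (k : Key K) (v₁ v₂ : Addr)
  | vlFail₂ (op : VOp) (k : Key K) (v₂ : Addr)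
  | vlDone (op : VOp) (k : Key K) (v₁ v₂ : Addr)
  /- `AddVertex` after the search -/
  | avNew (k : Key K) (v₁ v₂ : Addr)
  | avLink (v₁ v₂ v₃ : Addr)
  | avPublish (v₁ v₂ v₃ : Addr)
  /- `RemoveVertex` after the search -/
  | rvMark (v₁ v₂ : Addr)
  | rvRead (v₁ v₂ : Addr)
  | rvUnlink (v₁ v₂ : Addr) (w : Option Addr)
  /- release of the vertex locks, then return `b` -/
  | vUnlock₁ (v₁ v₂ : Addr) (b : Bool)
  | vUnlock₂ (v₂ : Addr) (b : Bool)
  /- `HelpSearchEdge`; `swap` tells that `key₂` is searched for before `key₁` -/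
  | hsFirst (op : EOp) (k₁ k₂ : Key K) (swap : Bool) (v : Addr)
  | hsNext (op : EOp) (k₁ k₂ : Key K) (swap : Bool) (w : Addr)
  | hsSecond (op : EOp) (k₁ k₂ : Key K) (swap : Bool) (w v : Addr)
  | hsDone (op : EOp) (k₁ k₂ : Key K) (v₁ v₂ : Addr)
  /- the second test of the two vertices in `AcyclicLocateEdge` -/
  | leMarked₁ (mode : EMode) (k₁ k₂ : Key K) (v₁ v₂ : Addr)
  | leMarked₂ (mode : EMode) (k₁ k₂ : Key K) (v₁ v₂ : Addr)
  /- the loop of `AcyclicLocateEdge` and of `NewLocateEdge`, with validation -/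
  | elStart (mode : EMode) (k₁ k₂ : Key K) (v₁ : Addr)
  | elScan (mode : EMode) (k₁ k₂ : Key K) (v₁ e₁ e₂ : Addr)
  | elLock₁ (mode : EMode) (k₁ k₂ : Key K) (v₁ e₁ e₂ : Addr)
  | elLock₂ (mode : EMode) (k₁ k₂ : Key K) (v₁ e₁ e₂ : Addr)
  | elCheck₁ (mode : EMode) (k₁ k₂ : Key K) (v₁ e₁ e₂ : Addr)
  | elCheck₂ (mode : EMode) (k₁ k₂ : Key K) (v₁ e₁ e₂ : Addr)
  | elCheck₃ (mode : EMode) (k₁ k₂ : Key K) (v₁ e₁ e₂ : Addr)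
  | elFail₁ (mode : EMode) (k₁ k₂ : Key K) (v₁ e₁ e₂ : Addr)
  | elFail₂ (mode : EMode) (k₁ k₂ : Key K) (v₁ e₂ : Addr)
  | elDone (mode : EMode) (k₁ k₂ : Key K) (v₁ e₁ e₂ : Addr)
  /- `AcyclicAddEdge`: insertion of the new node in transit -/
  | aeNew (k₁ k₂ : Key K) (v₁ e₁ e₂ : Addr)
  | aeLink (c : AddCtx K) (e₁ e₂ : Addr)
  | aePublish (c : AddCtx K) (e₁ e₂ : Addr)
  | aeUnlock₁ (c : AddCtx K) (e₁ e₂ : Addr)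
  | aeUnlock₂ (c : AddCtx K) (e₂ : Addr)
  /- `PathExists(key₂, key₁)`: `R` is the local set of reached keys, `X` the set of explored keys,
  `x` the key being explored -/
  | peVertex (c : AddCtx K) (R X : Set (Key K)) (x : Key K) (v : Addr)
  | peEdge (c : AddCtx K) (R X : Set (Key K)) (x : Key K) (e : Addr)
  | peStatus (c : AddCtx K) (R X : Set (Key K)) (x : Key K) (e : Addr)
  | peNext (c : AddCtx K) (R X : Set (Key K)) (x : Key K) (e : Addr)
  | peTest (c : AddCtx K) (R X : Set (Key K)) (x : Key K)
  | peLoop (c : AddCtx K) (R X : Set (Key K))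
  | peDone (c : AddCtx K) (cycle : Bool)
  /- marking and unlinking of the edge node `d`, by `AcyclicRemoveEdge` or by `AcyclicAddEdge`
  after a detected cycle; then release of the locks of `e₁`, `e₂` and return of `b` -/
  | reMark (e₁ e₂ d : Addr) (b : Bool)
  | reRead (e₁ e₂ : Addr) (b : Bool)
  | reUnlink (e₁ e₂ : Addr) (w : Option Addr) (b : Bool)
  | eUnlock₁ (e₁ e₂ : Addr) (b : Bool)
  | eUnlock₂ (e₂ : Addr) (b : Bool)
  /- `AcyclicContainsEdge` after `HelpSearchEdge` -/
  | ceScan (k₂ : Key K) (e : Addr)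

open PC

/-- One atomic step of thread `t`, from shared memory and program point to shared memory and
program point. Node fields `val`, `edgeHead` and `edgeTail` never change after creation, so reading
them is not a step of its own. -/
inductive ThreadStep {T K : Type*} [LinearOrder K] (σ : Status) (t : T) :
    Mem T K → PC K → Mem T K → PC K → Prop
  /- invocations and responses -/
  | callAddVertex (m k) : ThreadStep σ t m idle m (vlStart .add (Key.of k))
  | callRemoveVertex (m k) : ThreadStep σ t m idle m (vlStart .remove (Key.of k))
  | callContainsVertex (m k) : ThreadStep σ t m idle m (cvScan (Key.of k) vertexHead)
  | callEdge (m op k₁ k₂ swap) :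
      ThreadStep σ t m idle m (hsFirst op (Key.of k₁) (Key.of k₂) swap vertexHead)
  | respond (m b) : ThreadStep σ t m (ret b) m idle
  /- ContainsVertex -/
  | cvNext (m k v n w) : m.vnode v = some n → n.val < k → n.vnext = some w →
      ThreadStep σ t m (cvScan k v) m (cvScan k w)
  | cvAbsent (m k v n) : m.vnode v = some n → k < n.val →
      ThreadStep σ t m (cvScan k v) m (ret false)
  | cvFound (m k v n) : m.vnode v = some n → n.val = k →
      ThreadStep σ t m (cvScan k v) m (ret (!n.marked))
  /- LocateVertex -/
  | vlStart (m op k n w) : m.vnode vertexHead = some n → n.vnext = some w →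
      ThreadStep σ t m (vlStart op k) m (vlScan op k vertexHead w)
  | vlNext (m op k v₁ v₂ n w) : m.vnode v₂ = some n → n.val < k → n.vnext = some w →
      ThreadStep σ t m (vlScan op k v₁ v₂) m (vlScan op k v₂ w)
  | vlStop (m op k v₁ v₂ n) : m.vnode v₂ = some n → k ≤ n.val →
      ThreadStep σ t m (vlScan op k v₁ v₂) m (vlLock₁ op k v₁ v₂)
  | vlLock₁ (m op k v₁ v₂ n) : m.vnode v₁ = some n → n.lock = none →
      ThreadStep σ t m (vlLock₁ op k v₁ v₂)
        (m.setV v₁ { n with lock := some t }) (vlLock₂ op k v₁ v₂)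
  | vlLock₂ (m op k v₁ v₂ n) : m.vnode v₂ = some n → n.lock = none →
      ThreadStep σ t m (vlLock₂ op k v₁ v₂)
        (m.setV v₂ { n with lock := some t }) (vlCheck₁ op k v₁ v₂)
  /- ValidateVertex -/
  | vlCheck₁_ok (m op k v₁ v₂ n) : m.vnode v₁ = some n → n.marked = false →
      ThreadStep σ t m (vlCheck₁ op k v₁ v₂) m (vlCheck₂ op k v₁ v₂)
  | vlCheck₁_fail (m op k v₁ v₂ n) : m.vnode v₁ = some n → n.marked = true →
      ThreadStep σ t m (vlCheck₁ op k v₁ v₂) m (vlFail₁ op k v₁ v₂)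
  | vlCheck₂_ok (m op k v₁ v₂ n) : m.vnode v₂ = some n → n.marked = false →
      ThreadStep σ t m (vlCheck₂ op k v₁ v₂) m (vlCheck₃ op k v₁ v₂)
  | vlCheck₂_fail (m op k v₁ v₂ n) : m.vnode v₂ = some n → n.marked = true →
      ThreadStep σ t m (vlCheck₂ op k v₁ v₂) m (vlFail₁ op k v₁ v₂)
  | vlCheck₃_ok (m op k v₁ v₂ n) : m.vnode v₁ = some n → n.vnext = some v₂ →
      ThreadStep σ t m (vlCheck₃ op k v₁ v₂) m (vlDone op k v₁ v₂)
  | vlCheck₃_fail (m op k v₁ v₂ n) : m.vnode v₁ = some n → n.vnext ≠ some v₂ →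
      ThreadStep σ t m (vlCheck₃ op k v₁ v₂) m (vlFail₁ op k v₁ v₂)
  | vlFail₁ (m op k v₁ v₂ n) : m.vnode v₁ = some n →
      ThreadStep σ t m (vlFail₁ op k v₁ v₂) (m.setV v₁ { n with lock := none }) (vlFail₂ op k v₂)
  | vlFail₂ (m op k v₂ n) : m.vnode v₂ = some n →
      ThreadStep σ t m (vlFail₂ op k v₂) (m.setV v₂ { n with lock := none }) (vlStart op k)
  /- AddVertex -/
  | avAbsent (m k v₁ v₂ n) : m.vnode v₂ = some n → n.val ≠ k →
      ThreadStep σ t m (vlDone .add k v₁ v₂) m (avNew k v₁ v₂)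
  | avPresent (m k v₁ v₂ n) : m.vnode v₂ = some n → n.val = k →
      ThreadStep σ t m (vlDone .add k v₁ v₂) m (vUnlock₁ v₁ v₂ true)
  | avNew (m k v₁ v₂ v₃ h l) : m.vnode v₃ = none → m.enode h = none → m.enode l = none → h ≠ l →
      ThreadStep σ t m (avNew k v₁ v₂) (m.newV σ v₃ h l k) (avLink v₁ v₂ v₃)
  | avLink (m v₁ v₂ v₃ n) : m.vnode v₃ = some n →
      ThreadStep σ t m (avLink v₁ v₂ v₃) (m.setV v₃ { n with vnext := some v₂ })
        (avPublish v₁ v₂ v₃)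
  | avPublish (m v₁ v₂ v₃ n) : m.vnode v₁ = some n →
      ThreadStep σ t m (avPublish v₁ v₂ v₃) (m.setV v₁ { n with vnext := some v₃ })
        (vUnlock₁ v₁ v₂ true)
  /- RemoveVertex -/
  | rvPresent (m k v₁ v₂ n) : m.vnode v₂ = some n → n.val = k →
      ThreadStep σ t m (vlDone .remove k v₁ v₂) m (rvMark v₁ v₂)
  | rvAbsent (m k v₁ v₂ n) : m.vnode v₂ = some n → n.val ≠ k →
      ThreadStep σ t m (vlDone .remove k v₁ v₂) m (vUnlock₁ v₁ v₂ false)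
  | rvMark (m v₁ v₂ n) : m.vnode v₂ = some n →
      ThreadStep σ t m (rvMark v₁ v₂) (m.setV v₂ { n with marked := true }) (rvRead v₁ v₂)
  | rvRead (m v₁ v₂ n) : m.vnode v₂ = some n →
      ThreadStep σ t m (rvRead v₁ v₂) m (rvUnlink v₁ v₂ n.vnext)
  | rvUnlink (m v₁ v₂ w n) : m.vnode v₁ = some n →
      ThreadStep σ t m (rvUnlink v₁ v₂ w) (m.setV v₁ { n with vnext := w }) (vUnlock₁ v₁ v₂ true)
  | vUnlock₁ (m v₁ v₂ b n) : m.vnode v₁ = some n →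
      ThreadStep σ t m (vUnlock₁ v₁ v₂ b) (m.setV v₁ { n with lock := none }) (vUnlock₂ v₂ b)
  | vUnlock₂ (m v₂ b n) : m.vnode v₂ = some n →
      ThreadStep σ t m (vUnlock₂ v₂ b) (m.setV v₂ { n with lock := none }) (ret b)
  /- HelpSearchEdge: the second search starts at the successor of the vertex node found by the first
  one or again at VertexHead. -/
  | hsFirstNext (m op k₁ k₂ swap v n w) : m.vnode v = some n →
      n.val < (if swap then k₂ else k₁) → n.vnext = some w →
      ThreadStep σ t m (hsFirst op k₁ k₂ swap v) m (hsFirst op k₁ k₂ swap w)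
  | hsFirstFound (m op k₁ k₂ swap v n) : m.vnode v = some n →
      n.val = (if swap then k₂ else k₁) → n.marked = false →
      ThreadStep σ t m (hsFirst op k₁ k₂ swap v) m (hsNext op k₁ k₂ swap v)
  | hsFirstAbsent (m op k₁ k₂ swap v n) : m.vnode v = some n →
      ((if swap then k₂ else k₁) < n.val ∨
        n.val = (if swap then k₂ else k₁) ∧ n.marked = true) →
      ThreadStep σ t m (hsFirst op k₁ k₂ swap v) m (ret false)
  | hsNextSucc (m op k₁ k₂ swap w n v) : m.vnode w = some n → n.vnext = some v →
      ThreadStep σ t m (hsNext op k₁ k₂ swap w) m (hsSecond op k₁ k₂ swap w v)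
  | hsNextHead (m op k₁ k₂ swap w) :
      ThreadStep σ t m (hsNext op k₁ k₂ swap w) m (hsSecond op k₁ k₂ swap w vertexHead)
  | hsSecondNext (m op k₁ k₂ swap w v n v') : m.vnode v = some n →
      n.val < (if swap then k₁ else k₂) → n.vnext = some v' →
      ThreadStep σ t m (hsSecond op k₁ k₂ swap w v) m (hsSecond op k₁ k₂ swap w v')
  | hsSecondFound (m op k₁ k₂ swap w v n) : m.vnode v = some n →
      n.val = (if swap then k₁ else k₂) → n.marked = false →
      ThreadStep σ t m (hsSecond op k₁ k₂ swap w v) m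
        (hsDone op k₁ k₂ (if swap then v else w) (if swap then w else v))
  | hsSecondAbsent (m op k₁ k₂ swap w v n) : m.vnode v = some n →
      ((if swap then k₁ else k₂) < n.val ∨
        n.val = (if swap then k₁ else k₂) ∧ n.marked = true) →
      ThreadStep σ t m (hsSecond op k₁ k₂ swap w v) m (ret false)
  | hsDoneAdd (m k₁ k₂ v₁ v₂) :
      ThreadStep σ t m (hsDone .add k₁ k₂ v₁ v₂) m (leMarked₁ .add k₁ k₂ v₁ v₂)
  | hsDoneRemove (m k₁ k₂ v₁ v₂) :
      ThreadStep σ t m (hsDone .remove k₁ k₂ v₁ v₂) m (leMarked₁ .remove k₁ k₂ v₁ v₂)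
  | hsDoneContains (m k₁ k₂ v₁ v₂ n) : m.vnode v₁ = some n →
      ThreadStep σ t m (hsDone .contains k₁ k₂ v₁ v₂) m (ceScan k₂ n.edgeHead)
  /- AcyclicContainsEdge -/
  | ceNext (m k₂ e n w) : m.enode e = some n → n.val < k₂ → n.enext = some w →
      ThreadStep σ t m (ceScan k₂ e) m (ceScan k₂ w)
  | ceTrue (m k₂ e n) : m.enode e = some n → n.val = k₂ → n.status = .added →
      ThreadStep σ t m (ceScan k₂ e) m (ret true)
  | ceFalse (m k₂ e n) : m.enode e = some n → (k₂ < n.val ∨ n.val = k₂ ∧ n.status ≠ .added) →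
      ThreadStep σ t m (ceScan k₂ e) m (ret false)
  /- AcyclicLocateEdge: second test of the vertex nodes -/
  | leMarked₁_ok (m mode k₁ k₂ v₁ v₂ n) : m.vnode v₁ = some n → n.marked = false →
      ThreadStep σ t m (leMarked₁ mode k₁ k₂ v₁ v₂) m (leMarked₂ mode k₁ k₂ v₁ v₂)
  | leMarked₁_fail (m mode k₁ k₂ v₁ v₂ n) : m.vnode v₁ = some n → n.marked = true →
      ThreadStep σ t m (leMarked₁ mode k₁ k₂ v₁ v₂) m (ret false)
  | leMarked₂_ok (m mode k₁ k₂ v₁ v₂ n) : m.vnode v₂ = some n → n.marked = false →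
      ThreadStep σ t m (leMarked₂ mode k₁ k₂ v₁ v₂) m (elStart mode k₁ k₂ v₁)
  | leMarked₂_fail (m mode k₁ k₂ v₁ v₂ n) : m.vnode v₂ = some n → n.marked = true →
      ThreadStep σ t m (leMarked₂ mode k₁ k₂ v₁ v₂) m (ret false)
  /- search and locking in the edge list of `v₁` -/
  | elStart (m mode k₁ k₂ v₁ n h w) : m.vnode v₁ = some n →
      m.enode n.edgeHead = some h → h.enext = some w →
      ThreadStep σ t m (elStart mode k₁ k₂ v₁) m (elScan mode k₁ k₂ v₁ n.edgeHead w)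
  | elNext (m mode k₁ k₂ v₁ e₁ e₂ n w) : m.enode e₂ = some n → n.val < k₂ → n.enext = some w →
      ThreadStep σ t m (elScan mode k₁ k₂ v₁ e₁ e₂) m (elScan mode k₁ k₂ v₁ e₂ w)
  | elStop (m mode k₁ k₂ v₁ e₁ e₂ n) : m.enode e₂ = some n → k₂ ≤ n.val →
      ThreadStep σ t m (elScan mode k₁ k₂ v₁ e₁ e₂) m (elLock₁ mode k₁ k₂ v₁ e₁ e₂)
  | elLock₁ (m mode k₁ k₂ v₁ e₁ e₂ n) : m.enode e₁ = some n → n.lock = none →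
      ThreadStep σ t m (elLock₁ mode k₁ k₂ v₁ e₁ e₂)
        (m.setE e₁ { n with lock := some t }) (elLock₂ mode k₁ k₂ v₁ e₁ e₂)
  | elLock₂ (m mode k₁ k₂ v₁ e₁ e₂ n) : m.enode e₂ = some n → n.lock = none →
      ThreadStep σ t m (elLock₂ mode k₁ k₂ v₁ e₁ e₂)
        (m.setE e₂ { n with lock := some t }) (elCheck₁ mode k₁ k₂ v₁ e₁ e₂)
  | elCheck₁_ok (m mode k₁ k₂ v₁ e₁ e₂ n) : m.enode e₁ = some n → mode.Valid n.status →
      ThreadStep σ t m (elCheck₁ mode k₁ k₂ v₁ e₁ e₂) m (elCheck₂ mode k₁ k₂ v₁ e₁ e₂)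
  | elCheck₁_fail (m mode k₁ k₂ v₁ e₁ e₂ n) : m.enode e₁ = some n → ¬ mode.Valid n.status →
      ThreadStep σ t m (elCheck₁ mode k₁ k₂ v₁ e₁ e₂) m (elFail₁ mode k₁ k₂ v₁ e₁ e₂)
  | elCheck₂_ok (m mode k₁ k₂ v₁ e₁ e₂ n) : m.enode e₂ = some n → mode.Valid n.status →
      ThreadStep σ t m (elCheck₂ mode k₁ k₂ v₁ e₁ e₂) m (elCheck₃ mode k₁ k₂ v₁ e₁ e₂)
  | elCheck₂_fail (m mode k₁ k₂ v₁ e₁ e₂ n) : m.enode e₂ = some n → ¬ mode.Valid n.status →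
      ThreadStep σ t m (elCheck₂ mode k₁ k₂ v₁ e₁ e₂) m (elFail₁ mode k₁ k₂ v₁ e₁ e₂)
  | elCheck₃_ok (m mode k₁ k₂ v₁ e₁ e₂ n) : m.enode e₁ = some n → n.enext = some e₂ →
      ThreadStep σ t m (elCheck₃ mode k₁ k₂ v₁ e₁ e₂) m (elDone mode k₁ k₂ v₁ e₁ e₂)
  | elCheck₃_fail (m mode k₁ k₂ v₁ e₁ e₂ n) : m.enode e₁ = some n → n.enext ≠ some e₂ →
      ThreadStep σ t m (elCheck₃ mode k₁ k₂ v₁ e₁ e₂) m (elFail₁ mode k₁ k₂ v₁ e₁ e₂)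
  | elFail₁ (m mode k₁ k₂ v₁ e₁ e₂ n) : m.enode e₁ = some n →
      ThreadStep σ t m (elFail₁ mode k₁ k₂ v₁ e₁ e₂)
        (m.setE e₁ { n with lock := none }) (elFail₂ mode k₁ k₂ v₁ e₂)
  | elFail₂ (m mode k₁ k₂ v₁ e₂ n) : m.enode e₂ = some n →
      ThreadStep σ t m (elFail₂ mode k₁ k₂ v₁ e₂)
        (m.setE e₂ { n with lock := none }) (elStart mode k₁ k₂ v₁)
  /- AcyclicAddEdge: insertion of a new edge node in transit -/
  | aePresent (m k₁ k₂ v₁ e₁ e₂ n) : m.enode e₂ = some n → n.val = k₂ →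
      ThreadStep σ t m (elDone .add k₁ k₂ v₁ e₁ e₂) m (eUnlock₁ e₁ e₂ true)
  | aeAbsent (m k₁ k₂ v₁ e₁ e₂ n) : m.enode e₂ = some n → n.val ≠ k₂ →
      ThreadStep σ t m (elDone .add k₁ k₂ v₁ e₁ e₂) m (aeNew k₁ k₂ v₁ e₁ e₂)
  | aeNew (m k₁ k₂ v₁ e₁ e₂ e₃) : m.enode e₃ = none →
      ThreadStep σ t m (aeNew k₁ k₂ v₁ e₁ e₂) (m.newE e₃ k₂) (aeLink ⟨k₁, k₂, v₁, e₃⟩ e₁ e₂)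
  | aeLink (m c e₁ e₂ n) : m.enode c.e₃ = some n →
      ThreadStep σ t m (aeLink c e₁ e₂) (m.setE c.e₃ { n with enext := some e₂ })
        (aePublish c e₁ e₂)
  | aePublish (m c e₁ e₂ n) : m.enode e₁ = some n →
      ThreadStep σ t m (aePublish c e₁ e₂) (m.setE e₁ { n with enext := some c.e₃ })
        (aeUnlock₁ c e₁ e₂)
  | aeUnlock₁ (m c e₁ e₂ n) : m.enode e₁ = some n →
      ThreadStep σ t m (aeUnlock₁ c e₁ e₂) (m.setE e₁ { n with lock := none }) (aeUnlock₂ c e₂)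
  | aeUnlock₂ (m c e₂ n) : m.enode e₂ = some n →
      ThreadStep σ t m (aeUnlock₂ c e₂) (m.setE e₂ { n with lock := none })
        (peVertex c ∅ ∅ c.k₂ vertexHead)
  /- PathExists -/
  | peVertexNext (m c R X x v n w) : m.vnode v = some n → n.val < x → n.vnext = some w →
      ThreadStep σ t m (peVertex c R X x v) m (peVertex c R X x w)
  | peVertexAbsent (m c R X x v n) : m.vnode v = some n →
      (x < n.val ∨ n.val = x ∧ n.marked = true) →
      ThreadStep σ t m (peVertex c R X x v) m (peLoop c R (insert x X))
  | peVertexFound (m c R X x v n) : m.vnode v = some n → n.val = x → n.marked = false →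
      ThreadStep σ t m (peVertex c R X x v) m (peEdge c R X x n.edgeHead)
  | peEdgeMore (m c R X x e n) : m.enode e = some n → n.enext ≠ none →
      ThreadStep σ t m (peEdge c R X x e) m (peStatus c R X x e)
  | peEdgeEnd (m c R X x e n) : m.enode e = some n → n.enext = none →
      ThreadStep σ t m (peEdge c R X x e) m (peTest c R X x)
  | peStatusUnmarked (m c R X x e n) : m.enode e = some n → n.status ≠ .marked →
      ThreadStep σ t m (peStatus c R X x e) m (peNext c (insert n.val R) X x e)
  | peStatusMarked (m c R X x e n) : m.enode e = some n → n.status = .marked →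
      ThreadStep σ t m (peStatus c R X x e) m (peNext c R X x e)
  | peNext (m c R X x e n w) : m.enode e = some n → n.enext = some w →
      ThreadStep σ t m (peNext c R X x e) m (peEdge c R X x w)
  | peTestFound (m c R X x) : c.k₁ ∈ R →
      ThreadStep σ t m (peTest c R X x) m (peDone c true)
  | peTestNotFound (m c R X x) : c.k₁ ∉ R →
      ThreadStep σ t m (peTest c R X x) m (peLoop c R (insert x X))
  | peLoopMore (m c R X x) : x ∈ R → x ∉ X →
      ThreadStep σ t m (peLoop c R X) m (peVertex c R X x vertexHead)
  | peLoopEnd (m c R X) : R ⊆ X →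
      ThreadStep σ t m (peLoop c R X) m (peDone c false)
  /- AcyclicAddEdge after PathExists -/
  | aeCommit (m c n) : m.enode c.e₃ = some n →
      ThreadStep σ t m (peDone c false) (m.setE c.e₃ { n with status := .added }) (ret true)
  | aeCycle (m c) :
      ThreadStep σ t m (peDone c true) m (elStart (.undo c.e₃) c.k₁ c.k₂ c.v₁)
  | aeUndo (m e₃ k₁ k₂ v₁ e₁ e₂) :
      ThreadStep σ t m (elDone (.undo e₃) k₁ k₂ v₁ e₁ e₂) m (reMark e₁ e₂ e₃ false)
  /- AcyclicRemoveEdge -/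
  | rePresent (m k₁ k₂ v₁ e₁ e₂ n) : m.enode e₂ = some n → n.val = k₂ →
      ThreadStep σ t m (elDone .remove k₁ k₂ v₁ e₁ e₂) m (reMark e₁ e₂ e₂ true)
  | reAbsent (m k₁ k₂ v₁ e₁ e₂ n) : m.enode e₂ = some n → n.val ≠ k₂ →
      ThreadStep σ t m (elDone .remove k₁ k₂ v₁ e₁ e₂) m (eUnlock₁ e₁ e₂ true)
  /- marking, unlinking, release -/
  | reMark (m e₁ e₂ d b n) : m.enode d = some n →
      ThreadStep σ t m (reMark e₁ e₂ d b) (m.setE d { n with status := .marked }) (reRead e₁ e₂ b)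
  | reRead (m e₁ e₂ b n) : m.enode e₂ = some n →
      ThreadStep σ t m (reRead e₁ e₂ b) m (reUnlink e₁ e₂ n.enext b)
  | reUnlink (m e₁ e₂ w b n) : m.enode e₁ = some n →
      ThreadStep σ t m (reUnlink e₁ e₂ w b) (m.setE e₁ { n with enext := w }) (eUnlock₁ e₁ e₂ b)
  | eUnlock₁ (m e₁ e₂ b n) : m.enode e₁ = some n →
      ThreadStep σ t m (eUnlock₁ e₁ e₂ b) (m.setE e₁ { n with lock := none }) (eUnlock₂ e₂ b)
  | eUnlock₂ (m e₂ b n) : m.enode e₂ = some n →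
      ThreadStep σ t m (eUnlock₂ e₂ b) (m.setE e₂ { n with lock := none }) (ret b)

/-- A global state: the shared memory and the program point of every thread. -/
structure State (T K : Type*) where
  mem : Mem T K
  pc : T → PC K

/-- The initial state: the empty graph, all threads idle. -/
def initState (σ : Status) (T K : Type*) : State T K := ⟨initMem σ T K, fun _ => idle⟩

/-- One step of the system: some thread makes one atomic step. -/
inductive Step {T K : Type*} [DecidableEq T] [LinearOrder K] (σ : Status) :
    State T K → State T K → Prop
  | mk (s : State T K) (t : T) (m' : Mem T K) (p' : PC K) :
      ThreadStep σ t s.mem (s.pc t) m' p' → Step σ s ⟨m', Function.update s.pc t p'⟩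

/-- `s 0, s 1, …` is an execution: it starts in the initial state, and every state is followed by
the result of one step or by itself (so that finite executions are included). -/
def IsExecution {T K : Type*} [DecidableEq T] [LinearOrder K] (σ : Status)
    (s : ℕ → State T K) : Prop :=
  s 0 = initState σ T K ∧ ∀ i, Step σ (s i) (s (i + 1)) ∨ s (i + 1) = s i

namespace Mem

variable {T K : Type*}

/-- `b` is reachable from `a` along `vnext` pointers. -/
def VReach (m : Mem T K) : Addr → Addr → Prop :=
  Relation.ReflTransGen fun a b => ∃ n, m.vnode a = some n ∧ n.vnext = some b

/-- `b` is reachable from `a` along `enext` pointers. -/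
def EReach (m : Mem T K) : Addr → Addr → Prop :=
  Relation.ReflTransGen fun a b => ∃ n, m.enode a = some n ∧ n.enext = some b

/-- `n` is an unmarked vertex node with key `u` reachable from `VertexHead`. -/
def IsVertexNode (m : Mem T K) (u : K) (n : VNode T K) : Prop :=
  ∃ a, m.VReach vertexHead a ∧ m.vnode a = some n ∧ n.val = Key.of u ∧ n.marked = false

/-- `(u, v)` is an edge of the graph with status `added`: `u` and `v` are vertices of the graph, and
an edge node with key `v` and status `added` is reachable in the edge list of `u`. -/
def AddedEdge (m : Mem T K) (u v : K) : Prop :=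
  ∃ n, m.IsVertexNode u n ∧ (∃ n', m.IsVertexNode v n') ∧
    ∃ a e, m.EReach n.edgeHead a ∧ m.enode a = some e ∧ e.val = Key.of v ∧ e.status = .added

end Mem

/-- A relation has no cycle: no nonempty walk leads from a point back to itself. -/
def Acyclic {K : Type*} (r : K → K → Prop) : Prop := ∀ u, ¬ Relation.TransGen r u u

end ConcGraph

/-! Call an edge node, in transit or added, in the edge list of a published unmarked vertex node a
present arc. Call a set `S` of arcs cyclic if every arc of `S` lies on a cycle of arcs of `S`. The
heart of the invariant `Inv` is this: whenever all arcs of a nonempty cyclic set `S` are present,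
some thread is in the middle of an edge insertion whose own edge node belongs to `S`, is still in
transit, and is bound to be marked and never committed (`Detects`). A cycle of added edges would
give a cyclic set without any node in transit, so there is none (`Detects.exists_eMine`,
`Inv.acyclic`).

Why this is preserved. Marks are never taken back and a vertex node is published with an empty edge
list, so an arc becomes present only when its edge node is published. Hence if `S` is present after
a step, either the step published an arc of `S`, and its thread becomes the detector of `S`, or `S`
was present before and has a detector already. While `S` stays present, the detector's search from
`k₂` for `k₁` cannot miss an arc of `S`. The lists are sorted, only marked nodes are bypassed, and
an unlinked node keeps its own pointer, so an unmarked node ahead of a traversal remains reachable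
from where the traversal stands (`Keeps`). If the search ended with every reached key explored, the
reached keys would contain the successors along `S` of every explored key. As `S` leads from `k₂`
back to `k₁`, the key `k₁` would then have been reached (`mem_of_explored`). So the search answers
true, and the thread undoes its insertion. As soon as one arc of `S` disappears, nothing is claimed
about `S`. Spurious detections do no harm.

The undo must take out the thread's own node. This holds because the unmarked nodes of one edge list
are linearly ordered by reachability and by key (`undo_eq`).

The rest is a rely-guarantee argument: an invariant `Global` of the memory, an assertion `Local` at
each program point, and the interference `Rely` that it survives. `ThreadStep.outcome` treats every
atomic step. Locks protect the pointers that are rewritten. An edge removal marks only nodes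
validated as added, so a node in transit is marked by its creator alone. -/

namespace ConcGraph

open PC Relation

/-- Auxiliary history: the published vertex nodes, the vertex node to whose edge list an edge node
belongs (`none` before publication), and the threads that created the nodes. -/
structure Ghost (T : Type*) where
  vp : Set Addr
  own : Addr → Option Addr
  vcr : Addr → Option T
  ecr : Addr → Option T

/-! ### Linked lists as partial successor functions -/

/-- Reachability along a partial successor function. -/
def Reach (f : Addr → Option Addr) : Addr → Addr → Prop :=
  ReflTransGen fun a b => f a = some b

section Reach

variable {f : Addr → Option Addr} {a b c x y z : Addr}

theorem Reach.cases (h : Reach f x y) : x = y ∨ ∃ z, f x = some z ∧ Reach f z y :=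
  ReflTransGen.cases_head h

theorem Reach.head (h : f x = some z) (h' : Reach f z y) : Reach f x y :=
  ReflTransGen.head h h'

theorem Reach.mono {f' : Addr → Option Addr} (h : ∀ a b, f a = some b → f' a = some b)
    (hr : Reach f x y) : Reach f' x y :=
  ReflTransGen.mono h _ _ hr

/-- No path leaves `a`, so a successor given to `a` can only add paths. This covers the
initialisation of a node that is not yet published. -/
theorem Reach.update_none (ha : f a = none) (w : Option Addr) (hr : Reach f x y) :
    Reach (Function.update f a w) x y := by
  refine hr.mono fun d e h => ?_
  rw [Function.update_of_ne (by rintro rfl; simp [ha] at h)]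
  exact h

/-- A path that uses the pointer from `a` to `b` is rerouted through `c`. -/
theorem Reach.insert (hab : f a = some b) (hcb : f c = some b) (hca : c ≠ a)
    (hr : Reach f x y) : Reach (Function.update f a (some c)) x y := by
  induction hr using ReflTransGen.head_induction_on with
  | refl => exact ReflTransGen.refl
  | @head d e hde _ ih =>
    by_cases hd : d = a
    · subst hd
      obtain rfl : b = e := by simpa [hab] using hde
      refine Reach.head (z := c) (by simp) (Reach.head (z := b) ?_ ih)
      rwa [Function.update_of_ne hca]
    · exact Reach.head (by rwa [Function.update_of_ne hd]) ih

/-- A path through `a` and `b` that does not end in `b` goes on to `f b`, the new successor of `a`.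
The pointer of `b` itself is untouched, so a traversal that stands on the unlinked node loses
nothing. -/
theorem Reach.unlink (hab : f a = some b) (hne : b ≠ a) (hy : y ≠ b) (hr : Reach f x y) :
    Reach (Function.update f a (f b)) x y := by
  induction hr using ReflTransGen.head_induction_on with
  | refl => exact ReflTransGen.refl
  | @head d e hde _ ih =>
    by_cases hd : d = a
    · subst hd
      obtain rfl : b = e := by simpa [hab] using hde
      rcases Reach.cases ih with h | ⟨z, hz, h⟩
      · exact absurd h.symm hy
      · rw [Function.update_of_ne hne] at hz
        exact Reach.head (z := z) (by simp [hz]) h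
    · exact Reach.head (by rwa [Function.update_of_ne hd]) ih

theorem Reach.total (h : Reach f x y) (h' : Reach f x z) : Reach f y z ∨ Reach f z y :=
  ReflTransGen.total_of_right_unique (fun _ _ _ h₁ h₂ => by simpa [h₁] using h₂) h h'

end Reach

namespace Mem

variable {T K : Type*}

def vnx (m : Mem T K) (a : Addr) : Option Addr := (m.vnode a).bind VNode.vnext

def enx (m : Mem T K) (a : Addr) : Option Addr := (m.enode a).bind ENode.enext

theorem vReach_eq (m : Mem T K) : m.VReach = Reach m.vnx := by
  unfold VReach Reach vnx
  congr 1
  funext a b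
  simp [Option.bind_eq_some_iff]

theorem eReach_eq (m : Mem T K) : m.EReach = Reach m.enx := by
  unfold EReach Reach enx
  congr 1
  funext a b
  simp [Option.bind_eq_some_iff]

theorem vnx_setV (m : Mem T K) (a : Addr) (n : VNode T K) :
    (m.setV a n).vnx = Function.update m.vnx a n.vnext := by
  funext b
  by_cases h : b = a <;> simp [vnx, setV, h]

theorem enx_setE (m : Mem T K) (a : Addr) (n : ENode T K) :
    (m.setE a n).enx = Function.update m.enx a n.enext := by
  funext b
  by_cases h : b = a <;> simp [enx, setE, h]

@[simp] theorem setV_enode (m : Mem T K) (a : Addr) (n : VNode T K) :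
    (m.setV a n).enode = m.enode := rfl

theorem setV_vnode (m : Mem T K) (a : Addr) (n : VNode T K) (b : Addr) :
    (m.setV a n).vnode b = if b = a then some n else m.vnode b := by
  simp [setV, Function.update_apply]

theorem setE_enode (m : Mem T K) (a : Addr) (n : ENode T K) (b : Addr) :
    (m.setE a n).enode b = if b = a then some n else m.enode b := by
  simp [setE, Function.update_apply]

end Mem

variable {T K : Type*}

/-! ### The invariant of the shared memory -/

section Invariant

variable [LinearOrder K]

/-- The invariant of the shared memory. -/
structure Global (m : Mem T K) (g : Ghost T) : Prop where
  v_alloc : ∀ a, a ∈ g.vp → ∃ n, m.vnode a = some n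
  v_head : vertexHead ∈ g.vp
  v_bot : ∃ n, m.vnode vertexHead = some n ∧ n.val = ⊥
  v_next : ∀ a n b, m.vnode a = some n → n.vnext = some b →
    b ∈ g.vp ∧ ∃ n', m.vnode b = some n' ∧ n.val < n'.val
  v_reach : ∀ a n, a ∈ g.vp → m.vnode a = some n → n.marked = false → m.VReach vertexHead a
  v_lock : ∀ a n t, m.vnode a = some n → n.lock = some t → a ∈ g.vp
  v_cr : ∀ a t, g.vcr a = some t → ∃ n, m.vnode a = some n
  v_edge : ∀ a n, m.vnode a = some n →
    g.own n.edgeHead = some a ∧ ∃ h, m.enode n.edgeHead = some h ∧ h.val = ⊥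
  e_alloc : ∀ e w, g.own e = some w → (∃ n, m.enode e = some n) ∧ ∃ n, m.vnode w = some n
  e_next : ∀ e n f, m.enode e = some n → n.enext = some f →
    ∃ n', m.enode f = some n' ∧ n.val < n'.val
  e_own : ∀ e n f w, g.own e = some w → m.enode e = some n → n.enext = some f → g.own f = some w
  e_last : ∀ e n w, g.own e = some w → m.enode e = some n → n.enext = none → n.val = ⊤
  -- The vertex node `w` itself may be marked, unlinked or not yet published.
  e_reach : ∀ e n w v, g.own e = some w → m.vnode w = some v → m.enode e = some n →
    n.status ≠ .marked → m.EReach v.edgeHead e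
  e_lock : ∀ e n t, m.enode e = some n → n.lock = some t → g.own e ≠ none
  e_cr : ∀ e t, g.ecr e = some t → ∃ n, m.enode e = some n

/-- Keys increase strictly along pointers, including those of unlinked and unpublished nodes. This
is what lets a sorted search conclude that a node is absent. -/
theorem Global.vReach_lt {m : Mem T K} {g : Ghost T} (G : Global m g) {a b : Addr}
    (h : m.VReach a b) {n n' : VNode T K} (hn : m.vnode a = some n) (hn' : m.vnode b = some n') :
    a = b ∨ n.val < n'.val := by
  induction h using ReflTransGen.head_induction_on generalizing n with
  | refl => exact .inl rfl
  | head h _ ih =>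
    obtain ⟨n₁, h₁, h₂⟩ := h
    obtain ⟨-, n₂, h₃, h₄⟩ := G.v_next _ _ _ h₁ h₂
    obtain rfl : n = n₁ := by simpa [hn] using h₁
    rcases ih h₃ with rfl | h₅
    · obtain rfl : n₂ = n' := by simpa [h₃] using hn'
      exact .inr h₄
    · exact .inr (h₄.trans h₅)

theorem Global.eReach_lt {m : Mem T K} {g : Ghost T} (G : Global m g) {a b : Addr}
    (h : m.EReach a b) {n n' : ENode T K} (hn : m.enode a = some n) (hn' : m.enode b = some n') :
    a = b ∨ n.val < n'.val := by
  induction h using ReflTransGen.head_induction_on generalizing n with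
  | refl => exact .inl rfl
  | head h _ ih =>
    obtain ⟨n₁, h₁, h₂⟩ := h
    obtain ⟨n₂, h₃, h₄⟩ := G.e_next _ _ _ h₁ h₂
    obtain rfl : n = n₁ := by simpa [hn] using h₁
    rcases ih h₃ with rfl | h₅
    · obtain rfl : n₂ = n' := by simpa [h₃] using hn'
      exact .inr h₄
    · exact .inr (h₄.trans h₅)

theorem Global.vReach_vp {m : Mem T K} {g : Ghost T} (G : Global m g) {a b : Addr}
    (h : m.VReach a b) (ha : a ∈ g.vp) : b ∈ g.vp := by
  induction h with
  | refl => exact ha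
  | tail _ h _ =>
    obtain ⟨n, h₁, h₂⟩ := h
    exact (G.v_next _ _ _ h₁ h₂).1

theorem Global.eReach_own {m : Mem T K} {g : Ghost T} (G : Global m g) {a b w : Addr}
    (h : m.EReach a b) (ha : g.own a = some w) : g.own b = some w := by
  induction h with
  | refl => exact ha
  | tail _ h ih =>
    obtain ⟨n, h₁, h₂⟩ := h
    exact G.e_own _ _ _ _ ih h₁ h₂

end Invariant

/-! ### Interference and the assertions at the program points -/

/-- What thread `t` may assume about the steps of the other threads. -/
structure Rely (t : T) (m : Mem T K) (g : Ghost T) (m' : Mem T K) (g' : Ghost T) : Prop where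
  vp : ∀ a, a ∈ g.vp → a ∈ g'.vp
  own : ∀ e w, g.own e = some w → g'.own e = some w
  ecr : ∀ e, g.ecr e = some t → g'.ecr e = some t
  vnode : ∀ a n, m.vnode a = some n →
    ∃ n', m'.vnode a = some n' ∧ n'.val = n.val ∧ (n.lock = some t → n' = n)
  enode : ∀ e n, m.enode e = some n → ∃ n', m'.enode e = some n' ∧ n'.val = n.val ∧
    -- Unlike a locked vertex node, a locked edge node is not frozen: its creator may change its
    -- status from transit to added without holding the lock.
    (n.lock = some t → n'.lock = some t ∧ n'.enext = n.enext ∧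
      (n.status ≠ .marked → n'.status ≠ .marked) ∧ (n.status = .added → n'.status = .added)) ∧
    (n.status = .marked → n'.status = .marked) ∧
    (g.ecr e = some t → n.status = .transit → n'.status = .transit)
  vpriv : ∀ a, g.vcr a = some t → a ∉ g.vp → g'.vcr a = some t ∧ a ∉ g'.vp ∧
    m'.vnode a = m.vnode a ∧ ∀ e, g'.own e = some a → g.own e = some a
  epriv : ∀ e, g.ecr e = some t → g.own e = none → g'.own e = none ∧ m'.enode e = m.enode e

/-- Reachability of unmarked nodes persists. -/
structure Keeps (m m' : Mem T K) : Prop where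
  v : ∀ a b n, m'.vnode b = some n → n.marked = false → m.VReach a b → m'.VReach a b
  e : ∀ a b n, m'.enode b = some n → n.status ≠ .marked → m.EReach a b → m'.EReach a b

section Atoms

variable [LinearOrder K] (m : Mem T K) (g : Ghost T) (t : T)

def VVal (a : Addr) (P : Key K → Prop) : Prop := ∃ n, m.vnode a = some n ∧ P n.val

def VLk (a : Addr) (P : VNode T K → Prop) : Prop :=
  ∃ n, m.vnode a = some n ∧ n.lock = some t ∧ P n

/-- A vertex node that thread `t` has created but not published. -/
def VPriv (a : Addr) (w : Option Addr) : Prop :=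
  g.vcr a = some t ∧ a ∉ g.vp ∧ (∃ n, m.vnode a = some n ∧ n.vnext = w) ∧
    ∀ e n, g.own e = some a → m.enode e = some n → n.val = ⊥ ∨ n.val = ⊤

def EVal (e : Addr) (P : Key K → Prop) : Prop := ∃ n, m.enode e = some n ∧ P n.val

def ELk (e : Addr) : Prop := ∃ n, m.enode e = some n ∧ n.lock = some t

def ENx (e : Addr) (w : Option Addr) : Prop :=
  ∃ n, m.enode e = some n ∧ n.lock = some t ∧ n.enext = w

def EValid (e : Addr) (mode : EMode) : Prop :=
  ∃ n, m.enode e = some n ∧ n.lock = some t ∧ mode.Valid n.status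

def EMarked (e : Addr) : Prop := ∃ n, m.enode e = some n ∧ n.status = .marked

/-- An edge node in transit that thread `t` has created. -/
def EMine (e : Addr) : Prop :=
  g.ecr e = some t ∧ ∃ n, m.enode e = some n ∧ n.status = .transit

/-- An edge node that thread `t` may mark, to remove an edge (`b = true`) or to undo an insertion. -/
def EDoomed (e : Addr) (b : Bool) : Prop :=
  (b = true ∧ EValid m t e .remove) ∨ (b = false ∧ EMine m g t e)

/-- An edge node that thread `t` has created but not published. -/
def EPriv (e : Addr) (w : Option Addr) : Prop :=
  g.ecr e = some t ∧ g.own e = none ∧ ∃ n, m.enode e = some n ∧ n.enext = w ∧ n.status = .transit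

/-- The lower bound puts every head sentinel strictly before the key. The upper bound ensures that
the node to be marked and unlinked is not a tail sentinel. -/
def IsKey (k : Key K) : Prop := ⊥ < k ∧ k < ⊤

/-- The vertex node `v₁` of an edge operation. -/
def Src (k₁ k₂ : Key K) (v₁ : Addr) : Prop :=
  v₁ ∈ g.vp ∧ VVal m v₁ (· = k₁) ∧ IsKey k₂

/-- The published edge node `e₃` of thread `t`, in transit from `v₁` to `k₂`. -/
def Own (k₂ : Key K) (v₁ e₃ : Addr) : Prop :=
  EMine m g t e₃ ∧ g.own e₃ = some v₁ ∧ EVal m e₃ (· = k₂)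

def ModeOK (k₂ : Key K) (v₁ : Addr) : EMode → Prop
  | .undo e₃ => Own m g t k₂ v₁ e₃
  | _ => True

def Ctx (c : AddCtx K) : Prop := Src m g c.k₁ c.k₂ c.v₁ ∧ Own m g t c.k₂ c.v₁ c.e₃

def Loc (mode : EMode) (k₁ k₂ : Key K) (v₁ : Addr) : Prop :=
  Src m g k₁ k₂ v₁ ∧ ModeOK m g t k₂ v₁ mode

def Win (k₂ : Key K) (v₁ e₁ e₂ : Addr) : Prop :=
  g.own e₁ = some v₁ ∧ g.own e₂ = some v₁ ∧ EVal m e₁ (· < k₂) ∧ EVal m e₂ (k₂ ≤ ·)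

def VWin (k : Key K) (v₁ v₂ : Addr) : Prop :=
  ⊥ < k ∧ v₁ ∈ g.vp ∧ v₂ ∈ g.vp ∧ VVal m v₁ (· < k) ∧ VVal m v₂ (k ≤ ·)

/-- The locked place of insertion of a vertex node with key `k`. -/
def VGap (k : Key K) (v₁ v₂ : Addr) : Prop :=
  v₁ ∈ g.vp ∧ v₂ ∈ g.vp ∧ VVal m v₁ (· < k) ∧ VVal m v₂ (k < ·) ∧
    VLk m t v₁ (fun n => n.marked = false ∧ n.vnext = some v₂) ∧ VLk m t v₂ (fun _ => True)

/-- The locked place of insertion of an edge node with key `k₂`. -/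
def EGap (k₂ : Key K) (v₁ e₁ e₂ : Addr) : Prop :=
  g.own e₁ = some v₁ ∧ g.own e₂ = some v₁ ∧ EVal m e₁ (· < k₂) ∧ EVal m e₂ (k₂ < ·) ∧
    EValid m t e₁ .add ∧ ENx m t e₁ (some e₂) ∧ ELk m t e₂

/-- The assertion of thread `t` at a program point. -/
def Local : PC K → Prop
  | vlStart _ k => ⊥ < k
  | vlScan _ k v₁ v₂ => ⊥ < k ∧ v₁ ∈ g.vp ∧ v₂ ∈ g.vp ∧ VVal m v₁ (· < k)
  | vlLock₁ _ k v₁ v₂ => VWin m g k v₁ v₂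
  | vlLock₂ _ k v₁ v₂ => VWin m g k v₁ v₂ ∧ VLk m t v₁ (fun _ => True)
  | vlCheck₁ _ k v₁ v₂ => VWin m g k v₁ v₂ ∧ VLk m t v₁ (fun _ => True) ∧ VLk m t v₂ (fun _ => True)
  | vlFail₁ _ k v₁ v₂ => VWin m g k v₁ v₂ ∧ VLk m t v₁ (fun _ => True) ∧ VLk m t v₂ (fun _ => True)
  | vlCheck₂ _ k v₁ v₂ => VWin m g k v₁ v₂ ∧ VLk m t v₁ (fun n => n.marked = false) ∧
      VLk m t v₂ (fun _ => True)
  | vlCheck₃ _ k v₁ v₂ => VWin m g k v₁ v₂ ∧ VLk m t v₁ (fun n => n.marked = false) ∧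
      VLk m t v₂ (fun _ => True)
  | vlFail₂ _ k v₂ => ⊥ < k ∧ VLk m t v₂ (fun _ => True)
  | vlDone _ k v₁ v₂ => VWin m g k v₁ v₂ ∧
      VLk m t v₁ (fun n => n.marked = false ∧ n.vnext = some v₂) ∧ VLk m t v₂ (fun _ => True)
  | avNew k v₁ v₂ => VGap m g t k v₁ v₂
  | avLink v₁ v₂ v₃ => ∃ k, VGap m g t k v₁ v₂ ∧ VVal m v₃ (· = k) ∧ VPriv m g t v₃ none
  | avPublish v₁ v₂ v₃ => ∃ k, VGap m g t k v₁ v₂ ∧ VVal m v₃ (· = k) ∧ VPriv m g t v₃ (some v₂)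
  | rvMark v₁ v₂ => v₁ ≠ v₂ ∧ VLk m t v₁ (fun n => n.vnext = some v₂) ∧ VLk m t v₂ (fun _ => True)
  | rvRead v₁ v₂ => v₁ ≠ v₂ ∧ VLk m t v₁ (fun n => n.vnext = some v₂) ∧
      VLk m t v₂ (fun n => n.marked = true)
  | rvUnlink v₁ v₂ w => v₁ ≠ v₂ ∧ VLk m t v₁ (fun n => n.vnext = some v₂) ∧
      VLk m t v₂ (fun n => n.marked = true ∧ n.vnext = w)
  | vUnlock₁ v₁ v₂ _ => v₁ ≠ v₂ ∧ VLk m t v₁ (fun _ => True) ∧ VLk m t v₂ (fun _ => True)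
  | vUnlock₂ v₂ _ => VLk m t v₂ (fun _ => True)
  | hsFirst _ _ k₂ _ v => v ∈ g.vp ∧ IsKey k₂
  | hsNext _ k₁ k₂ swap w => w ∈ g.vp ∧ VVal m w (· = if swap then k₂ else k₁) ∧ IsKey k₂
  | hsSecond _ k₁ k₂ swap w v =>
      w ∈ g.vp ∧ VVal m w (· = if swap then k₂ else k₁) ∧ v ∈ g.vp ∧ IsKey k₂
  | hsDone _ k₁ k₂ v₁ _ => Src m g k₁ k₂ v₁
  | leMarked₁ mode k₁ k₂ v₁ _ => Loc m g t mode k₁ k₂ v₁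
  | leMarked₂ mode k₁ k₂ v₁ _ => Loc m g t mode k₁ k₂ v₁
  | elStart mode k₁ k₂ v₁ => Loc m g t mode k₁ k₂ v₁
  | elScan mode k₁ k₂ v₁ e₁ e₂ => Loc m g t mode k₁ k₂ v₁ ∧
      g.own e₁ = some v₁ ∧ g.own e₂ = some v₁ ∧ EVal m e₁ (· < k₂)
  | elLock₁ mode k₁ k₂ v₁ e₁ e₂ => Loc m g t mode k₁ k₂ v₁ ∧ Win m g k₂ v₁ e₁ e₂
  | elLock₂ mode k₁ k₂ v₁ e₁ e₂ => Loc m g t mode k₁ k₂ v₁ ∧ Win m g k₂ v₁ e₁ e₂ ∧ ELk m t e₁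
  | elCheck₁ mode k₁ k₂ v₁ e₁ e₂ => Loc m g t mode k₁ k₂ v₁ ∧ Win m g k₂ v₁ e₁ e₂ ∧
      ELk m t e₁ ∧ ELk m t e₂
  | elFail₁ mode k₁ k₂ v₁ e₁ e₂ => Loc m g t mode k₁ k₂ v₁ ∧ Win m g k₂ v₁ e₁ e₂ ∧
      ELk m t e₁ ∧ ELk m t e₂
  | elFail₂ mode k₁ k₂ v₁ e₂ => Loc m g t mode k₁ k₂ v₁ ∧ ELk m t e₂
  | elCheck₂ mode k₁ k₂ v₁ e₁ e₂ => Loc m g t mode k₁ k₂ v₁ ∧ Win m g k₂ v₁ e₁ e₂ ∧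
      EValid m t e₁ mode ∧ ELk m t e₂
  | elCheck₃ mode k₁ k₂ v₁ e₁ e₂ => Loc m g t mode k₁ k₂ v₁ ∧ Win m g k₂ v₁ e₁ e₂ ∧
      EValid m t e₁ mode ∧ EValid m t e₂ mode
  | elDone mode k₁ k₂ v₁ e₁ e₂ => Loc m g t mode k₁ k₂ v₁ ∧ Win m g k₂ v₁ e₁ e₂ ∧
      EValid m t e₁ mode ∧ EValid m t e₂ mode ∧ ENx m t e₁ (some e₂)
  | aeNew k₁ k₂ v₁ e₁ e₂ => Src m g k₁ k₂ v₁ ∧ EGap m g t k₂ v₁ e₁ e₂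
  | aeLink c e₁ e₂ => Src m g c.k₁ c.k₂ c.v₁ ∧ EGap m g t c.k₂ c.v₁ e₁ e₂ ∧
      EVal m c.e₃ (· = c.k₂) ∧ EPriv m g t c.e₃ none
  | aePublish c e₁ e₂ => Src m g c.k₁ c.k₂ c.v₁ ∧ EGap m g t c.k₂ c.v₁ e₁ e₂ ∧
      EVal m c.e₃ (· = c.k₂) ∧ EPriv m g t c.e₃ (some e₂)
  | aeUnlock₁ c e₁ e₂ => Ctx m g t c ∧ e₁ ≠ e₂ ∧ ELk m t e₁ ∧ ELk m t e₂
  | aeUnlock₂ c e₂ => Ctx m g t c ∧ ELk m t e₂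
  | peVertex c _ _ _ _ => Ctx m g t c
  | peEdge c _ _ _ _ => Ctx m g t c
  | peStatus c _ _ _ _ => Ctx m g t c
  | peNext c _ _ _ _ => Ctx m g t c
  | peTest c _ _ _ => Ctx m g t c
  | peLoop c _ _ => Ctx m g t c
  | peDone c _ => Ctx m g t c
  | reMark e₁ e₂ d b => d = e₂ ∧ e₁ ≠ e₂ ∧ ENx m t e₁ (some e₂) ∧ ELk m t e₂ ∧ EVal m e₂ (· < ⊤) ∧
      EDoomed m g t e₂ b
  | reRead e₁ e₂ _ => e₁ ≠ e₂ ∧ ENx m t e₁ (some e₂) ∧ ELk m t e₂ ∧ EVal m e₂ (· < ⊤) ∧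
      EMarked m e₂
  | reUnlink e₁ e₂ w _ => e₁ ≠ e₂ ∧ ENx m t e₁ (some e₂) ∧ ENx m t e₂ w ∧ EVal m e₂ (· < ⊤) ∧
      EMarked m e₂
  | eUnlock₁ e₁ e₂ _ => e₁ ≠ e₂ ∧ ELk m t e₁ ∧ ELk m t e₂
  | eUnlock₂ e₂ _ => ELk m t e₂
  | _ => True

end Atoms

/-! ### Stability of the assertions under interference -/

section Stable

variable {t : T} {m m' : Mem T K} {g g' : Ghost T} (h : Rely t m g m' g')
include h

theorem Rely.vVal {a : Addr} {P : Key K → Prop} : VVal m a P → VVal m' a P := by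
  rintro ⟨n, h₁, h₂⟩
  obtain ⟨n', h₃, h₄, -⟩ := h.vnode _ _ h₁
  exact ⟨n', h₃, h₄ ▸ h₂⟩

theorem Rely.vLk {a : Addr} {P : VNode T K → Prop} : VLk m t a P → VLk m' t a P := by
  rintro ⟨n, h₁, h₂, h₃⟩
  obtain ⟨n', h₄, -, h₅⟩ := h.vnode _ _ h₁
  obtain rfl := h₅ h₂
  exact ⟨n', h₄, h₂, h₃⟩

theorem Rely.eVal {a : Addr} {P : Key K → Prop} : EVal m a P → EVal m' a P := by
  rintro ⟨n, h₁, h₂⟩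
  obtain ⟨n', h₃, h₄, -⟩ := h.enode _ _ h₁
  exact ⟨n', h₃, h₄ ▸ h₂⟩

theorem Rely.eLk {a : Addr} : ELk m t a → ELk m' t a := by
  rintro ⟨n, h₁, h₂⟩
  obtain ⟨n', h₃, -, h₄, -⟩ := h.enode _ _ h₁
  exact ⟨n', h₃, (h₄ h₂).1⟩

theorem Rely.eNx {a : Addr} {w : Option Addr} : ENx m t a w → ENx m' t a w := by
  rintro ⟨n, h₁, h₂, rfl⟩
  obtain ⟨n', h₃, -, h₄, -⟩ := h.enode _ _ h₁
  exact ⟨n', h₃, (h₄ h₂).1, (h₄ h₂).2.1⟩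

/-- Both kinds of validation survive a concurrent commit, which turns transit into added: being
unmarked persists under the lock, and so does being added. -/
theorem Rely.eValid {a : Addr} {mode : EMode} : EValid m t a mode → EValid m' t a mode := by
  rintro ⟨n, h₁, h₂, h₅⟩
  obtain ⟨n', h₃, -, h₄, -⟩ := h.enode _ _ h₁
  obtain ⟨h₆, -, h₇, h₈⟩ := h₄ h₂
  refine ⟨n', h₃, h₆, ?_⟩
  cases mode
  · exact h₇ h₅
  · exact h₈ h₅
  · exact h₇ h₅

theorem Rely.eMarked {a : Addr} : EMarked m a → EMarked m' a := by
  rintro ⟨n, h₁, h₂⟩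
  obtain ⟨n', h₃, -, -, h₄, -⟩ := h.enode _ _ h₁
  exact ⟨n', h₃, h₄ h₂⟩

theorem Rely.eMine {a : Addr} : EMine m g t a → EMine m' g' t a := by
  rintro ⟨h₀, n, h₁, h₂⟩
  obtain ⟨n', h₃, -, -, -, h₄⟩ := h.enode _ _ h₁
  exact ⟨h.ecr _ h₀, n', h₃, h₄ h₀ h₂⟩

theorem Rely.eDoomed {a : Addr} {b : Bool} : EDoomed m g t a b → EDoomed m' g' t a b :=
  Or.imp (And.imp id h.eValid) (And.imp id h.eMine)

theorem Rely.ePriv {a : Addr} {w : Option Addr} : EPriv m g t a w → EPriv m' g' t a w := by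
  rintro ⟨h₀, h₁, n, h₂, h₃⟩
  obtain ⟨h₄, h₅⟩ := h.epriv _ h₀ h₁
  exact ⟨h.ecr _ h₀, h₄, n, h₅ ▸ h₂, h₃⟩

theorem Rely.ownOK {k₂ : Key K} {v₁ e₃ : Addr} : Own m g t k₂ v₁ e₃ → Own m' g' t k₂ v₁ e₃ :=
  And.imp h.eMine (And.imp (h.own _ _) h.eVal)

theorem Rely.modeOK {mode : EMode} {k₂ : Key K} {v₁ : Addr} :
    ModeOK m g t k₂ v₁ mode → ModeOK m' g' t k₂ v₁ mode := by
  cases mode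
  · exact id
  · exact id
  · exact h.ownOK

end Stable

section Stable

variable [LinearOrder K] {t : T} {m m' : Mem T K} {g g' : Ghost T} (h : Rely t m g m' g')
include h

/-- Other threads assign no edge node to an unpublished vertex node, so its edge list still consists
of sentinels. -/
theorem Rely.vPriv (G : Global m g) {a : Addr} {w : Option Addr} :
    VPriv m g t a w → VPriv m' g' t a w := by
  rintro ⟨h₁, h₂, ⟨n, h₃, h₄⟩, h₅⟩
  obtain ⟨h₆, h₇, h₈, h₉⟩ := h.vpriv _ h₁ h₂
  refine ⟨h₆, h₇, ⟨n, h₈ ▸ h₃, h₄⟩, fun e n he hn => ?_⟩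
  obtain ⟨⟨n₁, hn₁⟩, -⟩ := G.e_alloc _ _ (h₉ e he)
  obtain ⟨n₂, hn₂, hv, -⟩ := h.enode _ _ hn₁
  obtain rfl : n = n₂ := by simpa [hn] using hn₂
  exact hv ▸ h₅ e n₁ (h₉ e he) hn₁

theorem Rely.src {k₁ k₂ : Key K} {v₁ : Addr} : Src m g k₁ k₂ v₁ → Src m' g' k₁ k₂ v₁ :=
  And.imp (h.vp _) (And.imp h.vVal id)

theorem Rely.ctx {c : AddCtx K} : Ctx m g t c → Ctx m' g' t c :=
  And.imp h.src h.ownOK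

theorem Rely.loc {mode : EMode} {k₁ k₂ : Key K} {v₁ : Addr} :
    Loc m g t mode k₁ k₂ v₁ → Loc m' g' t mode k₁ k₂ v₁ :=
  And.imp h.src h.modeOK

theorem Rely.win {k₂ : Key K} {v₁ e₁ e₂ : Addr} : Win m g k₂ v₁ e₁ e₂ → Win m' g' k₂ v₁ e₁ e₂ :=
  And.imp (h.own _ _) (And.imp (h.own _ _) (And.imp h.eVal h.eVal))

theorem Rely.vWin {k : Key K} {v₁ v₂ : Addr} : VWin m g k v₁ v₂ → VWin m' g' k v₁ v₂ :=
  And.imp id (And.imp (h.vp _) (And.imp (h.vp _) (And.imp h.vVal h.vVal)))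

theorem Rely.vGap {k : Key K} {v₁ v₂ : Addr} : VGap m g t k v₁ v₂ → VGap m' g' t k v₁ v₂ :=
  And.imp (h.vp _) (And.imp (h.vp _)
    (And.imp h.vVal (And.imp h.vVal (And.imp h.vLk h.vLk))))

theorem Rely.eGap {k₂ : Key K} {v₁ e₁ e₂ : Addr} :
    EGap m g t k₂ v₁ e₁ e₂ → EGap m' g' t k₂ v₁ e₁ e₂ :=
  And.imp (h.own _ _) (And.imp (h.own _ _)
    (And.imp h.eVal (And.imp h.eVal (And.imp h.eValid (And.imp h.eNx h.eLk)))))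

/-- Each assertion is built by conjunctions and existential quantifiers from atoms that are stable
one by one. -/
theorem Rely.stable (G : Global m g) (p : PC K) : Local m g t p → Local m' g' t p := by
  cases p
  all_goals simp only [Local]
  all_goals repeat' first
    | exact id
    | exact h.vp _
    | exact h.own _ _
    | exact h.vVal
    | exact h.vLk
    | exact h.vPriv G
    | exact h.eVal
    | exact h.eLk
    | exact h.eNx
    | exact h.eValid
    | exact h.eMarked
    | exact h.eDoomed
    | exact h.ePriv
    | exact h.src
    | exact h.ctx
    | exact h.loc
    | exact h.win
    | exact h.vWin
    | exact h.vGap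
    | exact h.eGap
    | refine And.imp ?_ ?_
    | refine Exists.imp fun k => ?_

end Stable

/-! ### Cyclic sets of arcs and their detection -/

/-- An edge of the graph with its vertex node and its edge node. -/
structure Arc (K : Type*) where
  u : K
  w : Addr
  e : Addr
  v : K

/-- The arc is in the graph, in transit or added. -/
def Present (m : Mem T K) (g : Ghost T) (τ : Arc K) : Prop :=
  τ.w ∈ g.vp ∧ (∃ n, m.vnode τ.w = some n ∧ n.val = Key.of τ.u ∧ n.marked = false) ∧
    g.own τ.e = some τ.w ∧
    ∃ n, m.enode τ.e = some n ∧ n.val = Key.of τ.v ∧ n.status ≠ .marked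

/-- Forgets the nodes of the arcs, because `PathExists` passes from edge to edge by keys alone. -/
def ArcRel (S : Set (Arc K)) (x y : Key K) : Prop := ∃ τ ∈ S, Key.of τ.u = x ∧ Key.of τ.v = y

/-- Every arc of `S` lies on a cycle of arcs of `S`. -/
def Cyclic (S : Set (Arc K)) : Prop :=
  ∀ τ ∈ S, ReflTransGen (ArcRel S) (Key.of τ.v) (Key.of τ.u)

def HasE (S : Set (Arc K)) (e : Addr) : Prop := ∃ τ ∈ S, τ.e = e

/-- The mode of a thread that takes an edge node of `S` out again. -/
def ModeHas (S : Set (Arc K)) : EMode → Prop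
  | .undo e => HasE S e
  | _ => False

/-- The explored keys `X` have their successors along `S` in `R`; the key `b` is explored, or it is
the key `x` of the current exploration. -/
def Explored (S : Set (Arc K)) (R X : Set (Key K)) (b x : Key K) : Prop :=
  (∀ x ∈ X, ∀ y, ArcRel S x y → y ∈ R) ∧ (b ∈ X ∨ x = b)

/-- A thread at this program point has an edge node in transit among the arcs `S` and is going to
detect that these contain a cycle. -/
def Detects (m : Mem T K) (S : Set (Arc K)) : PC K → Prop
  | aeUnlock₁ c _ _ => HasE S c.e₃
  | aeUnlock₂ c _ => HasE S c.e₃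
  | peVertex c R X x v => HasE S c.e₃ ∧ Explored S R X c.k₂ x ∧ c.k₁ ∉ R ∧
      ∀ τ ∈ S, Key.of τ.u = x → m.VReach v τ.w
  | peEdge c R X x e => HasE S c.e₃ ∧ Explored S R X c.k₂ x ∧
      ∀ τ ∈ S, Key.of τ.u = x → m.EReach e τ.e ∨ Key.of τ.v ∈ R
  | peStatus c R X x e => HasE S c.e₃ ∧ Explored S R X c.k₂ x ∧
      ∀ τ ∈ S, Key.of τ.u = x → m.EReach e τ.e ∨ Key.of τ.v ∈ R
  | peNext c R X x e => HasE S c.e₃ ∧ Explored S R X c.k₂ x ∧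
      ∀ τ ∈ S, Key.of τ.u = x → (e ≠ τ.e ∧ m.EReach e τ.e) ∨ Key.of τ.v ∈ R
  | peTest c R X x => HasE S c.e₃ ∧ Explored S R X c.k₂ x ∧
      ∀ τ ∈ S, Key.of τ.u = x → Key.of τ.v ∈ R
  | peLoop c R X => HasE S c.e₃ ∧ (∀ x ∈ X, ∀ y, ArcRel S x y → y ∈ R) ∧ c.k₂ ∈ X ∧ c.k₁ ∉ R
  | peDone c b => b = true ∧ HasE S c.e₃
  | elStart mode _ _ _ => ModeHas S mode
  | elScan mode _ _ _ _ _ => ModeHas S mode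
  | elLock₁ mode _ _ _ _ _ => ModeHas S mode
  | elLock₂ mode _ _ _ _ _ => ModeHas S mode
  | elCheck₁ mode _ _ _ _ _ => ModeHas S mode
  | elCheck₂ mode _ _ _ _ _ => ModeHas S mode
  | elCheck₃ mode _ _ _ _ _ => ModeHas S mode
  | elFail₁ mode _ _ _ _ _ => ModeHas S mode
  | elFail₂ mode _ _ _ _ => ModeHas S mode
  | elDone mode _ _ _ _ _ => ModeHas S mode
  | reMark _ _ d b => b = false ∧ HasE S d
  | _ => False

/-- `Detects` depends on the memory only through reachability of the vertex and edge nodes of arcs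
of `S`. These are unmarked after the step, since `S` is still present, so their reachability
persists. -/
theorem Keeps.detects {m m' : Mem T K} {g' : Ghost T} (h : Keeps m m') {S : Set (Arc K)}
    (hS : ∀ τ ∈ S, Present m' g' τ) (p : PC K) : Detects m S p → Detects m' S p := by
  have hv : ∀ a, ∀ τ ∈ S, m.VReach a τ.w → m'.VReach a τ.w := fun a τ hτ => by
    obtain ⟨-, ⟨n, h₁, -, h₂⟩, -⟩ := hS τ hτ
    exact h.v a _ n h₁ h₂
  have he : ∀ a, ∀ τ ∈ S, m.EReach a τ.e → m'.EReach a τ.e := fun a τ hτ => by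
    obtain ⟨-, -, -, n, h₁, -, h₂⟩ := hS τ hτ
    exact h.e a _ n h₁ h₂
  cases p
  case peVertex => exact And.imp id (And.imp id (And.imp id fun H τ hτ hx => hv _ τ hτ (H τ hτ hx)))
  case peEdge => exact And.imp id (And.imp id fun H τ hτ hx => (H τ hτ hx).imp (he _ τ hτ) id)
  case peStatus => exact And.imp id (And.imp id fun H τ hτ hx => (H τ hτ hx).imp (he _ τ hτ) id)
  case peNext =>
    exact And.imp id (And.imp id fun H τ hτ hx => (H τ hτ hx).imp (And.imp id (he _ τ hτ)) id)
  all_goals exact id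

end ConcGraph

/-! ### Effect of a single memory access -/

namespace ConcGraph

open PC Relation

variable {T K : Type*}

theorem Rely.refl (t : T) (m : Mem T K) (g : Ghost T) : Rely t m g m g where
  vp _ := id
  own _ _ := id
  ecr _ := id
  vnode _ n h := ⟨n, h, rfl, fun _ => rfl⟩
  enode _ n h := ⟨n, h, rfl, fun h => ⟨h, rfl, id, id⟩, id, fun _ => id⟩
  vpriv _ h h' := ⟨h, h', rfl, fun _ => id⟩
  epriv _ _ h := ⟨h, rfl⟩

theorem vReach_setV_of_vnext {m : Mem T K} {a : Addr} {n n' : VNode T K}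
    (hn : m.vnode a = some n) (h : n'.vnext = n.vnext) :
    (m.setV a n').VReach = m.VReach := by
  rw [Mem.vReach_eq, Mem.vReach_eq, Mem.vnx_setV, h,
    show n.vnext = m.vnx a by simp [Mem.vnx, hn], Function.update_eq_self]

theorem eReach_setE_of_enext {m : Mem T K} {a : Addr} {n n' : ENode T K}
    (hn : m.enode a = some n) (h : n'.enext = n.enext) :
    (m.setE a n').EReach = m.EReach := by
  rw [Mem.eReach_eq, Mem.eReach_eq, Mem.enx_setE, h,
    show n.enext = m.enx a by simp [Mem.enx, hn], Function.update_eq_self]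

variable [LinearOrder K]

/-- A step of thread `t` on the shared memory that respects the invariant and the other threads and
publishes at most the edge nodes in `N`. -/
structure Trans (t : T) (m : Mem T K) (g : Ghost T) (m' : Mem T K) (g' : Ghost T) (N : Set Addr) :
    Prop where
  glob : Global m' g'
  rely : ∀ t', t' ≠ t → Rely t' m g m' g'
  keep : Keeps m m'
  back : ∀ τ, Present m' g' τ → Present m g τ ∨ τ.e ∈ N

theorem Global.trans_refl {m : Mem T K} {g : Ghost T} (G : Global m g) (t : T) :
    Trans t m g m g ∅ where
  glob := G
  rely t' _ := Rely.refl t' m g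
  keep := ⟨fun _ _ _ _ _ => id, fun _ _ _ _ _ => id⟩
  back _ := .inl

/-! ### Writes to vertex nodes -/

section Vertex

variable {m : Mem T K} {g : Ghost T} {t : T} {a : Addr} {n : VNode T K}

/-- The common part of all writes to a vertex node; the hypotheses are what remains to be checked
for each of them. The set `vp'` may contain newly published nodes, and the last clause of `hnew`
says that their edge lists are empty. -/
theorem Global.setV_trans (G : Global m g) {n' : VNode T K} {vp' : Set Addr}
    (hn : m.vnode a = some n) (hval : n'.val = n.val) (hhead : n'.edgeHead = n.edgeHead)
    (hmark : n.marked = true → n'.marked = true)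
    (hnext : ∀ b, n'.vnext = some b → b ∈ vp' ∧ ∃ nb, m.vnode b = some nb ∧ n.val < nb.val)
    (hlock : ∀ t, n'.lock = some t → a ∈ g.vp)
    (hkeep : ∀ x b nb, (m.setV a n').vnode b = some nb → nb.marked = false → m.VReach x b →
      (m.setV a n').VReach x b)
    (hvp : ∀ b, b ∈ g.vp → b ∈ vp')
    (hnew : ∀ b, b ∈ vp' → b ∈ g.vp ∨ ((∃ n, m.vnode b = some n) ∧
      (m.setV a n').VReach vertexHead b ∧ (∀ t', t' ≠ t → g.vcr b ≠ some t') ∧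
      ∀ e n, g.own e = some b → m.enode e = some n → n.val = ⊥ ∨ n.val = ⊤))
    (hlk : ∀ t', t' ≠ t → n.lock = some t' → n' = n)
    (hpriv : ∀ t', t' ≠ t → g.vcr a = some t' → a ∈ g.vp) :
    Trans t m g (m.setV a n') { g with vp := vp' } ∅ := by
  have hfwd : ∀ b nb, m.vnode b = some nb → ∃ nb', (m.setV a n').vnode b = some nb' ∧
      nb'.val = nb.val ∧ nb'.edgeHead = nb.edgeHead := by
    intro b nb hb
    by_cases h : b = a
    · subst h
      obtain rfl : n = nb := by simpa [hn] using hb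
      exact ⟨n', by simp [Mem.setV_vnode], hval, hhead⟩
    · exact ⟨nb, by simpa [Mem.setV_vnode, h] using hb, rfl, rfl⟩
  have hbwd : ∀ b nb', (m.setV a n').vnode b = some nb' → ∃ nb, m.vnode b = some nb ∧
      nb'.val = nb.val ∧ nb'.edgeHead = nb.edgeHead ∧ (nb'.marked = false → nb.marked = false) := by
    intro b nb' hb
    by_cases h : b = a
    · subst h
      obtain rfl : n' = nb' := by simpa [Mem.setV_vnode] using hb
      refine ⟨n, hn, hval, hhead, fun h => ?_⟩
      by_contra hc
      simp [hmark (by simpa using hc)] at h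
    · exact ⟨nb', by simpa [Mem.setV_vnode, h] using hb, rfl, rfl, id⟩
  refine ⟨⟨?_, ?_, ?_, ?_, ?_, ?_, ?_, ?_, ?_, ?_, ?_, ?_, ?_, ?_, ?_⟩, ?_, ⟨hkeep, ?_⟩, ?_⟩
  · intro b hb
    have : ∃ nb, m.vnode b = some nb := (hnew b hb).elim (G.v_alloc b) (·.1)
    obtain ⟨nb, h⟩ := this
    obtain ⟨nb', h, -⟩ := hfwd b nb h
    exact ⟨nb', h⟩
  · exact hvp _ G.v_head
  · obtain ⟨nb, h, h'⟩ := G.v_bot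
    obtain ⟨nb', h₁, h₂, -⟩ := hfwd _ nb h
    exact ⟨nb', h₁, h₂.trans h'⟩
  · intro b nb c hb hc
    by_cases h : b = a
    · subst h
      obtain rfl : n' = nb := by simpa [Mem.setV_vnode] using hb
      obtain ⟨h₁, nc, h₂, h₃⟩ := hnext c hc
      obtain ⟨nc', h₄, h₅, -⟩ := hfwd c nc h₂
      exact ⟨h₁, nc', h₄, by rwa [h₅, hval]⟩
    · rw [Mem.setV_vnode, if_neg h] at hb
      obtain ⟨h₁, nc, h₂, h₃⟩ := G.v_next _ _ _ hb hc
      obtain ⟨nc', h₄, h₅, -⟩ := hfwd c nc h₂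
      exact ⟨hvp _ h₁, nc', h₄, by rwa [h₅]⟩
  · intro b nb hb hb' hm
    rcases hnew b hb with h | h
    · obtain ⟨nb', h₁, -, -, h₂⟩ := hbwd b nb hb'
      exact hkeep _ _ _ hb' hm (G.v_reach b nb' h h₁ (h₂ hm))
    · exact h.2.1
  · intro b nb t' hb hl
    by_cases h : b = a
    · subst h
      obtain rfl : n' = nb := by simpa [Mem.setV_vnode] using hb
      exact hvp _ (hlock t' hl)
    · rw [Mem.setV_vnode, if_neg h] at hb
      exact hvp _ (G.v_lock _ _ _ hb hl)
  · intro b t' h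
    obtain ⟨nb, h⟩ := G.v_cr b t' h
    obtain ⟨nb', h, -⟩ := hfwd b nb h
    exact ⟨nb', h⟩
  · intro b nb hb
    obtain ⟨nb', h₁, -, h₂, -⟩ := hbwd b nb hb
    rw [h₂]
    exact G.v_edge b nb' h₁
  · intro e w h
    obtain ⟨h₁, nb, h₂⟩ := G.e_alloc e w h
    obtain ⟨nb', h, -⟩ := hfwd w nb h₂
    exact ⟨h₁, nb', h⟩
  · exact G.e_next
  · exact G.e_own
  · exact G.e_last
  · intro e ne w v h₁ h₂ h₃ h₄
    obtain ⟨v', h₅, -, h₆, -⟩ := hbwd w v h₂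
    rw [h₆]
    exact G.e_reach e ne w v' h₁ h₅ h₃ h₄
  · exact G.e_lock
  · exact G.e_cr
  · intro t' ht
    refine ⟨hvp, fun _ _ => id, fun _ => id, ?_, ?_, ?_, ?_⟩
    · intro b nb hb
      by_cases h : b = a
      · subst h
        obtain rfl : n = nb := by simpa [hn] using hb
        exact ⟨n', by simp [Mem.setV_vnode], hval, hlk t' ht⟩
      · exact ⟨nb, by simpa [Mem.setV_vnode, h] using hb, rfl, fun _ => rfl⟩
    · exact (Rely.refl t' m g).enode
    · intro b hb hb'
      refine ⟨hb, fun h => ?_, ?_, fun _ => id⟩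
      · rcases hnew b h with h | h
        · exact hb' h
        · exact h.2.2.1 t' ht hb
      · rw [Mem.setV_vnode, if_neg]
        rintro rfl
        exact hb' (hpriv t' ht hb)
    · exact (Rely.refl t' m g).epriv
  · exact fun _ _ _ _ _ => id
  · rintro τ ⟨h₁, ⟨nb, h₂, h₃, h₄⟩, h₅, ne, h₆, h₇, h₈⟩
    obtain ⟨nb', h₉, h₁₀, -, h₁₁⟩ := hbwd _ nb h₂
    refine .inl ⟨?_, ⟨nb', h₉, h₁₀ ▸ h₃, h₁₁ h₄⟩, h₅, ne, h₆, h₇, h₈⟩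
    rcases hnew _ h₁ with h | h
    · exact h
    -- A newly published vertex node owns only sentinels, whose keys are not keys of `K`, so it is
    -- the source of no arc.
    · rcases h.2.2.2 _ _ h₅ h₆ with h | h <;> rw [h] at h₇ <;> cases h₇

theorem Global.lockV_trans (G : Global m g) (hn : m.vnode a = some n)
    (hl : n.lock = none ∨ n.lock = some t) (ha : a ∈ g.vp) (l : Option T) :
    Trans t m g (m.setV a { n with lock := l }) g ∅ := by
  refine G.setV_trans hn rfl rfl id (fun b h => G.v_next _ _ _ hn h) (fun _ _ => ha) ?_
    (fun _ => id) (fun _ => .inl) ?_ fun _ _ _ => ha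
  · intro x b nb _ _ h
    rw [vReach_setV_of_vnext (n' := { n with lock := l }) hn rfl]
    exact h
  · intro t' ht h
    rcases hl with hl | hl <;> simp [hl] at h
    exact absurd h.symm ht

theorem Global.unlockV_trans (G : Global m g) (hn : m.vnode a = some n)
    (hl : n.lock = some t) : Trans t m g (m.setV a { n with lock := none }) g ∅ :=
  G.lockV_trans hn (.inr hl) (G.v_lock _ _ _ hn hl) none

theorem Global.markV_trans (G : Global m g) (hn : m.vnode a = some n)
    (hl : n.lock = some t) : Trans t m g (m.setV a { n with marked := true }) g ∅ := by
  have ha := G.v_lock _ _ _ hn hl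
  refine G.setV_trans hn rfl rfl (fun _ => rfl) (fun b h => G.v_next _ _ _ hn h) (fun _ _ => ha) ?_
    (fun _ => id) (fun _ => .inl) ?_ fun _ _ _ => ha
  · intro x b nb _ _ h
    rw [vReach_setV_of_vnext (n' := { n with marked := true }) hn rfl]
    exact h
  · intro t' ht h
    simp [hl] at h
    exact absurd h.symm ht

theorem Global.linkV_trans (G : Global m g) (hn : m.vnode a = some n) (hp : VPriv m g t a none)
    {b : Addr} {nb : VNode T K} (hb : b ∈ g.vp) (hnb : m.vnode b = some nb) (hlt : n.val < nb.val) :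
    Trans t m g (m.setV a { n with vnext := some b }) g ∅ := by
  obtain ⟨hp₁, hp₂, ⟨n₁, h₁, h₂⟩, -⟩ := hp
  obtain rfl : n = n₁ := by simpa [hn] using h₁
  refine G.setV_trans hn rfl rfl id ?_ (fun _ => G.v_lock a n _ hn) ?_
    (fun _ => id) (fun _ => .inl) ?_ ?_
  · rintro c h
    obtain rfl : b = c := by simpa using h
    exact ⟨hb, nb, hnb, hlt⟩
  · intro x c nc _ _ h
    rw [Mem.vReach_eq] at h ⊢
    rw [Mem.vnx_setV]
    exact h.update_none (by simp [Mem.vnx, hn, h₂]) _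
  · intro t' ht h
    exact absurd (G.v_lock _ _ _ hn h) hp₂
  · intro t' ht h
    simp [hp₁] at h
    exact absurd h.symm ht

/-- The predecessor `a` is locked and unmarked, hence reachable from `VertexHead`, and `c` becomes
reachable through it. Validation of the mark of `a` is needed exactly here: behind an unlinked node,
`c` would be lost. -/
theorem Global.publishV_trans (G : Global m g) (hn : m.vnode a = some n) (hl : n.lock = some t)
    (hu : n.marked = false) {b c : Addr} (hb : n.vnext = some b) (hp : VPriv m g t c (some b))
    {nc : VNode T K} (hc : m.vnode c = some nc) (hlt : n.val < nc.val) :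
    Trans t m g (m.setV a { n with vnext := some c }) { g with vp := insert c g.vp } ∅ := by
  have ha := G.v_lock _ _ _ hn hl
  obtain ⟨hp₁, hp₂, ⟨n₁, h₁, h₂⟩, h₃⟩ := hp
  obtain rfl : nc = n₁ := by simpa [hc] using h₁
  have hca : c ≠ a := by rintro rfl; exact hp₂ ha
  have hkeep : ∀ x y, m.VReach x y → (m.setV a { n with vnext := some c }).VReach x y := by
    intro x y h
    rw [Mem.vReach_eq] at h ⊢
    rw [Mem.vnx_setV]
    exact h.insert (b := b) (by simp [Mem.vnx, hn, hb]) (by simp [Mem.vnx, hc, h₂]) hca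
  refine G.setV_trans hn rfl rfl id ?_ (fun _ _ => ha) (fun x y _ _ _ => hkeep x y)
    (fun _ => .inr) ?_ ?_ fun _ _ _ => ha
  · rintro d h
    obtain rfl : c = d := by simpa using h
    exact ⟨.inl rfl, nc, hc, hlt⟩
  · rintro d (rfl | h)
    · refine .inr ⟨⟨nc, hc⟩, ?_, ?_, h₃⟩
      · exact (hkeep _ _ (G.v_reach _ _ ha hn hu)).tail ⟨_, by simp [Mem.setV_vnode]; rfl, rfl⟩
      · intro t' ht h
        simp [hp₁] at h
        exact ht h.symm
    · exact .inl h
  · intro t' ht h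
    simp [hl] at h
    exact absurd h.symm ht

/-- The bypassed node is marked, so no unmarked node ceases to be reachable. -/
theorem Global.unlinkV_trans (G : Global m g) (hn : m.vnode a = some n) (hl : n.lock = some t)
    {b : Addr} (hb : n.vnext = some b) {nb : VNode T K} (hnb : m.vnode b = some nb)
    (hm : nb.marked = true) :
    Trans t m g (m.setV a { n with vnext := nb.vnext }) g ∅ := by
  have ha := G.v_lock _ _ _ hn hl
  obtain ⟨-, nb', h₁, h₂⟩ := G.v_next _ _ _ hn hb
  obtain rfl : nb = nb' := by simpa [hnb] using h₁
  have hne : b ≠ a := by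
    rintro rfl
    obtain rfl : n = nb := by simpa [hn] using hnb
    exact lt_irrefl _ h₂
  refine G.setV_trans hn rfl rfl id ?_ (fun _ _ => ha) ?_ (fun _ => id) (fun _ => .inl) ?_
    fun _ _ _ => ha
  · intro d h
    obtain ⟨h₃, nd, h₄, h₅⟩ := G.v_next _ _ _ hnb h
    exact ⟨h₃, nd, h₄, h₂.trans h₅⟩
  · intro x y ny hy hym h
    rw [Mem.vReach_eq] at h ⊢
    rw [Mem.vnx_setV]
    have hyb : y ≠ b := by
      rintro rfl
      rw [Mem.setV_vnode, if_neg hne, hnb] at hy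
      obtain rfl : nb = ny := by simpa using hy
      simp [hm] at hym
    have := h.unlink (b := b) (a := a) (by simp [Mem.vnx, hn, hb]) hne hyb
    simpa [Mem.vnx, hnb] using this
  · intro t' ht h
    simp [hl] at h
    exact absurd h.symm ht

end Vertex

/-! ### Writes to edge nodes -/

section Edge

variable {m : Mem T K} {g : Ghost T} {t : T} {a : Addr} {n : ENode T K}

/-- The counterpart of `Global.setV_trans`. Here a write may assign an owner to the edge nodes in
`N`, and these alone can make new arcs present. -/
theorem Global.setE_trans (G : Global m g) {n' : ENode T K} {own' : Addr → Option Addr}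
    {N : Set Addr} (hn : m.enode a = some n) (hval : n'.val = n.val)
    (hmark : n.status = .marked → n'.status = .marked)
    (hnext : ∀ b, n'.enext = some b → ∃ nb, m.enode b = some nb ∧ n.val < nb.val)
    (hlock : ∀ t, n'.lock = some t → g.own a ≠ none)
    (hown : ∀ e w, g.own e = some w → own' e = some w)
    (hnew : ∀ e w, own' e = some w → g.own e = some w ∨ (e ∈ N ∧ g.own e = none ∧
      (∃ ne, m.enode e = some ne) ∧ (∀ t', t' ≠ t → g.ecr e ≠ some t') ∧ w ∈ g.vp ∧
      ∀ nw, m.vnode w = some nw → (m.setE a n').EReach nw.edgeHead e))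
    (hclosed : ∀ e ne f w, own' e = some w → (m.setE a n').enode e = some ne →
      ne.enext = some f → own' f = some w)
    (hlast : ∀ e ne w, own' e = some w → (m.setE a n').enode e = some ne → ne.enext = none →
      ne.val = ⊤)
    (hkeep : ∀ x b nb, (m.setE a n').enode b = some nb → nb.status ≠ .marked → m.EReach x b →
      (m.setE a n').EReach x b)
    (hlk : ∀ t', t' ≠ t → n.lock = some t' → n'.lock = some t' ∧ n'.enext = n.enext ∧
      (n.status ≠ .marked → n'.status ≠ .marked) ∧ (n.status = .added → n'.status = .added))
    (hmine : ∀ t', t' ≠ t → g.ecr a = some t' → n.status = .transit → n'.status = .transit)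
    (hpriv : ∀ t', t' ≠ t → g.ecr a = some t' → g.own a ≠ none) :
    Trans t m g (m.setE a n') { g with own := own' } N := by
  have hfwd : ∀ b nb, m.enode b = some nb → ∃ nb', (m.setE a n').enode b = some nb' ∧
      nb'.val = nb.val := by
    intro b nb hb
    by_cases h : b = a
    · subst h
      obtain rfl : n = nb := by simpa [hn] using hb
      exact ⟨n', by simp [Mem.setE_enode], hval⟩
    · exact ⟨nb, by simpa [Mem.setE_enode, h] using hb, rfl⟩
  have hbwd : ∀ b nb', (m.setE a n').enode b = some nb' → ∃ nb, m.enode b = some nb ∧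
      nb'.val = nb.val ∧ (nb'.status ≠ .marked → nb.status ≠ .marked) := by
    intro b nb' hb
    by_cases h : b = a
    · subst h
      obtain rfl : n' = nb' := by simpa [Mem.setE_enode] using hb
      exact ⟨n, hn, hval, mt hmark⟩
    · exact ⟨nb', by simpa [Mem.setE_enode, h] using hb, rfl, id⟩
  refine ⟨⟨G.v_alloc, G.v_head, G.v_bot, G.v_next, G.v_reach, G.v_lock, G.v_cr, ?_, ?_, ?_,
    hclosed, hlast, ?_, ?_, ?_⟩, ?_, ⟨fun _ _ _ _ _ => id, hkeep⟩, ?_⟩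
  · intro b nb hb
    obtain ⟨h₁, nh, h₂, h₃⟩ := G.v_edge b nb hb
    obtain ⟨nh', h₄, h₅⟩ := hfwd _ _ h₂
    exact ⟨hown _ _ h₁, nh', h₄, h₅.trans h₃⟩
  · intro e w h
    have : (∃ n, m.enode e = some n) ∧ ∃ n, m.vnode w = some n := by
      rcases hnew e w h with h | ⟨-, -, h₁, -, h₂, -⟩
      · exact G.e_alloc e w h
      · exact ⟨h₁, G.v_alloc _ h₂⟩
    obtain ⟨⟨ne, h₁⟩, h₂⟩ := this
    obtain ⟨ne', h₃, -⟩ := hfwd _ _ h₁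
    exact ⟨⟨ne', h₃⟩, h₂⟩
  · intro e ne f he hf
    have : ∃ nf, m.enode f = some nf ∧ ne.val < nf.val := by
      by_cases h : e = a
      · subst h
        obtain rfl : n' = ne := by simpa [Mem.setE_enode] using he
        rw [hval]
        exact hnext f hf
      · rw [Mem.setE_enode, if_neg h] at he
        exact G.e_next _ _ _ he hf
    obtain ⟨nf, h₁, h₂⟩ := this
    obtain ⟨nf', h₃, h₄⟩ := hfwd _ _ h₁
    exact ⟨nf', h₃, by rwa [h₄]⟩
  · intro e ne w v h₁ h₂ h₃ h₄
    rcases hnew e w h₁ with h | h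
    · obtain ⟨ne', h₅, -, h₆⟩ := hbwd e ne h₃
      exact hkeep _ _ _ h₃ h₄ (G.e_reach e ne' w v h h₂ h₅ (h₆ h₄))
    · exact h.2.2.2.2.2 v h₂
  · intro e ne t' he hl
    have : g.own e ≠ none := by
      by_cases h : e = a
      · subst h
        obtain rfl : n' = ne := by simpa [Mem.setE_enode] using he
        exact hlock t' hl
      · rw [Mem.setE_enode, if_neg h] at he
        exact G.e_lock _ _ _ he hl
    obtain ⟨w, hw⟩ := Option.ne_none_iff_exists'.1 this
    simp [hown _ _ hw]
  · intro e t' h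
    obtain ⟨ne, h⟩ := G.e_cr e t' h
    obtain ⟨ne', h, -⟩ := hfwd e ne h
    exact ⟨ne', h⟩
  · intro t' ht
    refine ⟨fun _ => id, hown, fun _ => id, (Rely.refl t' m g).vnode, ?_, ?_, ?_⟩
    · intro b nb hb
      by_cases h : b = a
      · subst h
        obtain rfl : n = nb := by simpa [hn] using hb
        exact ⟨n', by simp [Mem.setE_enode], hval, hlk t' ht, hmark, hmine t' ht⟩
      · exact ⟨nb, by simpa [Mem.setE_enode, h] using hb, rfl, fun h => ⟨h, rfl, id, id⟩, id,
          fun _ => id⟩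
    · intro b hb hb'
      refine ⟨hb, hb', rfl, fun e he => ?_⟩
      rcases hnew e b he with h | h
      · exact h
      · exact absurd h.2.2.2.2.1 hb'
    · intro e he he'
      refine ⟨?_, ?_⟩
      · by_contra hc
        obtain ⟨w, hw⟩ := Option.ne_none_iff_exists'.1 hc
        rcases hnew e w hw with h | h
        · simp [he'] at h
        · exact h.2.2.2.1 t' ht he
      · rw [Mem.setE_enode, if_neg]
        rintro rfl
        exact hpriv t' ht he he'
  · rintro τ ⟨h₁, h₂, h₅, ne, h₆, h₇, h₈⟩
    rcases hnew _ _ h₅ with h | h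
    · obtain ⟨ne', h₉, h₁₀, h₁₁⟩ := hbwd _ ne h₆
      exact .inl ⟨h₁, h₂, h, ne', h₉, h₁₀ ▸ h₇, h₁₁ h₈⟩
    · exact .inr h.1

/-- A write to `lock` or `status`. -/
theorem Global.setE_trans_of_enext (G : Global m g) {n' : ENode T K} (hn : m.enode a = some n)
    (hval : n'.val = n.val) (hnx : n'.enext = n.enext)
    (hmark : n.status = .marked → n'.status = .marked) (ha : g.own a ≠ none)
    (hlk : ∀ t', t' ≠ t → n.lock = some t' → n'.lock = some t' ∧
      (n.status ≠ .marked → n'.status ≠ .marked) ∧ (n.status = .added → n'.status = .added))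
    (hmine : ∀ t', t' ≠ t → g.ecr a = some t' → n.status = .transit → n'.status = .transit) :
    Trans t m g (m.setE a n') g ∅ := by
  have hbwd : ∀ b nb', (m.setE a n').enode b = some nb' → ∃ nb, m.enode b = some nb ∧
      nb'.val = nb.val ∧ nb'.enext = nb.enext := by
    intro b nb' hb
    by_cases h : b = a
    · subst h
      obtain rfl : n' = nb' := by simpa [Mem.setE_enode] using hb
      exact ⟨n, hn, hval, hnx⟩
    · exact ⟨nb', by simpa [Mem.setE_enode, h] using hb, rfl, rfl⟩
  refine G.setE_trans hn hval hmark (fun b h => G.e_next _ _ _ hn (hnx ▸ h)) (fun _ _ => ha)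
    (fun _ _ => id) (fun _ _ => .inl) ?_ ?_ ?_
    (fun t' ht h => ⟨(hlk t' ht h).1, hnx, (hlk t' ht h).2⟩) hmine fun _ _ _ => ha
  · intro e ne f w h₁ h₂ h₃
    obtain ⟨ne', h₄, -, h₅⟩ := hbwd e ne h₂
    exact G.e_own _ _ _ _ h₁ h₄ (h₅ ▸ h₃)
  · intro e ne w h₁ h₂ h₃
    obtain ⟨ne', h₄, h₅, h₆⟩ := hbwd e ne h₂
    rw [h₅]
    exact G.e_last _ _ _ h₁ h₄ (h₆ ▸ h₃)
  · intro x b nb _ _ h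
    rwa [eReach_setE_of_enext hn hnx]

theorem Global.lockE_trans (G : Global m g) (hn : m.enode a = some n)
    (hl : n.lock = none ∨ n.lock = some t) (ha : g.own a ≠ none) (l : Option T) :
    Trans t m g (m.setE a { n with lock := l }) g ∅ := by
  refine G.setE_trans_of_enext hn rfl rfl id ha ?_ fun _ _ _ => id
  intro t' ht h
  rcases hl with hl | hl <;> simp [hl] at h
  exact absurd h.symm ht

theorem Global.unlockE_trans (G : Global m g) (hn : m.enode a = some n) (hl : n.lock = some t) :
    Trans t m g (m.setE a { n with lock := none }) g ∅ :=
  G.lockE_trans hn (.inr hl) (G.e_lock _ _ _ hn hl) none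

/-- Another thread relies on its own node staying in transit. A removal has validated the status
added, and an undo marks a node of the marking thread, so neither touches a foreign node in transit.
-/
theorem Global.markE_trans (G : Global m g) (hn : m.enode a = some n) (hl : n.lock = some t)
    {b : Bool} (hd : EDoomed m g t a b) : Trans t m g (m.setE a { n with status := .marked }) g ∅ := by
  refine G.setE_trans_of_enext hn rfl rfl (fun _ => rfl) (G.e_lock _ _ _ hn hl) ?_ ?_
  · intro t' ht h
    simp [hl] at h
    exact absurd h.symm ht
  · intro t' ht h h'
    rcases hd with ⟨-, n₁, h₁, -, h₂⟩ | ⟨-, h₁, -⟩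
    · obtain rfl : n = n₁ := by simpa [hn] using h₁
      simp [EMode.Valid, h'] at h₂
    · simp [h₁] at h
      exact absurd h.symm ht

/-- No lock is required: a thread that holds the lock of this node relies only on an unmarked status
not becoming marked and on added remaining added. -/
theorem Global.commitE_trans (G : Global m g) (hn : m.enode a = some n) (hm : EMine m g t a)
    (ha : g.own a ≠ none) : Trans t m g (m.setE a { n with status := .added }) g ∅ := by
  obtain ⟨h₁, n₁, h₂, h₃⟩ := hm
  obtain rfl : n = n₁ := by simpa [hn] using h₂
  refine G.setE_trans_of_enext hn rfl rfl (by simp [h₃]) ha ?_ ?_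
  · intro t' ht h
    simp [h]
  · intro t' ht h
    simp [h₁] at h
    exact absurd h.symm ht

theorem Global.linkE_trans (G : Global m g) (hn : m.enode a = some n) (hp : EPriv m g t a none)
    {b : Addr} {nb : ENode T K} (hnb : m.enode b = some nb) (hlt : n.val < nb.val) :
    Trans t m g (m.setE a { n with enext := some b }) g ∅ := by
  obtain ⟨hp₁, hp₂, n₁, h₁, h₂, -⟩ := hp
  obtain rfl : n = n₁ := by simpa [hn] using h₁
  refine G.setE_trans hn rfl id ?_ (fun _ => G.e_lock a n _ hn) (fun _ _ => id)
    (fun _ _ => .inl) ?_ ?_ ?_ ?_ (fun _ _ _ => id) ?_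
  · rintro c h
    obtain rfl : b = c := by simpa using h
    exact ⟨nb, hnb, hlt⟩
  · intro e ne f w he hne
    rw [Mem.setE_enode, if_neg (by rintro rfl; simp [hp₂] at he)] at hne
    exact G.e_own _ _ _ _ he hne
  · intro e ne w he hne
    rw [Mem.setE_enode, if_neg (by rintro rfl; simp [hp₂] at he)] at hne
    exact G.e_last _ _ _ he hne
  · intro x c nc _ _ h
    rw [Mem.eReach_eq] at h ⊢
    rw [Mem.enx_setE]
    exact h.update_none (by simp [Mem.enx, hn, h₂]) _
  · intro t' ht h
    exact absurd hp₂ (G.e_lock _ _ _ hn h)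
  · intro t' ht h
    simp [hp₁] at h
    exact absurd h.symm ht

/-- The only kind of step that can make an arc present, whence the set `{c}`. The validated
predecessor `a` is unmarked, so it is in the list of `w`, and `c` joins that list behind it. -/
theorem Global.publishE_trans (G : Global m g) (hn : m.enode a = some n) (hl : n.lock = some t)
    (hu : n.status ≠ .marked) {b c w : Addr} (hb : n.enext = some b) (hw : g.own a = some w)
    (hwp : w ∈ g.vp) (hp : EPriv m g t c (some b)) {nc : ENode T K} (hc : m.enode c = some nc)
    (hlt : n.val < nc.val) :
    Trans t m g (m.setE a { n with enext := some c })
      { g with own := Function.update g.own c (some w) } {c} := by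
  obtain ⟨hp₁, hp₂, n₁, h₁, h₂, h₃⟩ := hp
  obtain rfl : nc = n₁ := by simpa [hc] using h₁
  have hca : c ≠ a := by rintro rfl; simp [hp₂] at hw
  have hkeep : ∀ x y, m.EReach x y → (m.setE a { n with enext := some c }).EReach x y := by
    intro x y h
    rw [Mem.eReach_eq] at h ⊢
    rw [Mem.enx_setE]
    exact h.insert (b := b) (by simp [Mem.enx, hn, hb]) (by simp [Mem.enx, hc, h₂]) hca
  have hown : ∀ e w', g.own e = some w' → Function.update g.own c (some w) e = some w' := by
    intro e w' h
    rwa [Function.update_of_ne]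
    rintro rfl
    simp [hp₂] at h
  refine G.setE_trans hn rfl id ?_ (fun _ _ => by simp [hw]) hown ?_ ?_ ?_
    (fun x y _ _ _ => hkeep x y) ?_ (fun _ _ _ => id) fun _ _ _ => by simp [hw]
  · rintro d h
    obtain rfl : c = d := by simpa using h
    exact ⟨nc, hc, hlt⟩
  · intro e w' h
    by_cases he : e = c
    · subst he
      obtain rfl : w = w' := by simpa using h
      refine .inr ⟨rfl, hp₂, ⟨nc, hc⟩, ?_, hwp, fun nw hnw => ?_⟩
      · intro t' ht h
        simp [hp₁] at h
        exact ht h.symm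
      · exact (hkeep _ _ (G.e_reach _ _ _ _ hw hnw hn hu)).tail
          ⟨_, by simp [Mem.setE_enode]; rfl, rfl⟩
    · rw [Function.update_of_ne he] at h
      exact .inl h
  · intro e ne f w' h₄ h₅ h₆
    by_cases he : e = c
    · subst he
      rw [Mem.setE_enode, if_neg hca, hc] at h₅
      obtain rfl : nc = ne := by simpa using h₅
      obtain rfl : b = f := by simpa [h₂] using h₆
      obtain rfl : w = w' := by simpa using h₄
      exact hown _ _ (G.e_own _ _ _ _ hw hn hb)
    · rw [Function.update_of_ne he] at h₄
      by_cases he' : e = a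
      · subst he'
        obtain rfl := by simpa [Mem.setE_enode] using h₅
        obtain rfl : c = f := by simpa using h₆
        obtain rfl : w = w' := by simpa [hw] using h₄
        simp
      · rw [Mem.setE_enode, if_neg he'] at h₅
        exact hown _ _ (G.e_own _ _ _ _ h₄ h₅ h₆)
  · intro e ne w' h₄ h₅ h₆
    by_cases he : e = c
    · subst he
      rw [Mem.setE_enode, if_neg hca, hc] at h₅
      obtain rfl : nc = ne := by simpa using h₅
      simp [h₂] at h₆
    · rw [Function.update_of_ne he] at h₄
      by_cases he' : e = a
      · subst he'
        obtain rfl := by simpa [Mem.setE_enode] using h₅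
        simp at h₆
      · rw [Mem.setE_enode, if_neg he'] at h₅
        exact G.e_last _ _ _ h₄ h₅ h₆
  · intro t' ht h
    simp [hl] at h
    exact absurd h.symm ht

/-- As for vertex nodes, only a marked node is bypassed. In addition `htop` excludes the tail
sentinel, so that every list still ends in a node with key `⊤`. -/
theorem Global.unlinkE_trans (G : Global m g) (hn : m.enode a = some n) (hl : n.lock = some t)
    {b : Addr} (hb : n.enext = some b) {nb : ENode T K} (hnb : m.enode b = some nb)
    (hm : nb.status = .marked) (htop : nb.val < ⊤) :
    Trans t m g (m.setE a { n with enext := nb.enext }) g ∅ := by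
  have ha := G.e_lock _ _ _ hn hl
  obtain ⟨nb', h₁, h₂⟩ := G.e_next _ _ _ hn hb
  obtain rfl : nb = nb' := by simpa [hnb] using h₁
  have hne : b ≠ a := by
    rintro rfl
    obtain rfl : n = nb := by simpa [hn] using hnb
    exact lt_irrefl _ h₂
  refine G.setE_trans hn rfl id ?_ (fun _ _ => ha) (fun _ _ => id) (fun _ _ => .inl) ?_ ?_ ?_ ?_
    (fun _ _ _ => id) fun _ _ _ => ha
  · intro d h
    obtain ⟨nd, h₄, h₅⟩ := G.e_next _ _ _ hnb h
    exact ⟨nd, h₄, h₂.trans h₅⟩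
  · intro e ne f w h₄ h₅ h₆
    by_cases he : e = a
    · subst he
      obtain rfl := by simpa [Mem.setE_enode] using h₅
      exact G.e_own _ _ _ _ (G.e_own _ _ _ _ h₄ hn hb) hnb h₆
    · rw [Mem.setE_enode, if_neg he] at h₅
      exact G.e_own _ _ _ _ h₄ h₅ h₆
  · intro e ne w h₄ h₅ h₆
    by_cases he : e = a
    · subst he
      obtain rfl := by simpa [Mem.setE_enode] using h₅
      exact absurd (G.e_last _ _ _ (G.e_own _ _ _ _ h₄ hn hb) hnb h₆) htop.ne
    · rw [Mem.setE_enode, if_neg he] at h₅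
      exact G.e_last _ _ _ h₄ h₅ h₆
  · intro x y ny hy hym h
    rw [Mem.eReach_eq] at h ⊢
    rw [Mem.enx_setE]
    have hyb : y ≠ b := by
      rintro rfl
      rw [Mem.setE_enode, if_neg hne, hnb] at hy
      obtain rfl : nb = ny := by simpa using hy
      exact hym hm
    have := h.unlink (b := b) (a := a) (by simp [Mem.enx, hn, hb]) hne hyb
    simpa [Mem.enx, hnb] using this
  · intro t' ht h
    simp [hl] at h
    exact absurd h.symm ht

end Edge

/-! ### Creation of nodes -/

section New

variable {m : Mem T K} {g : Ghost T}

theorem Global.newE_trans (G : Global m g) (t : T) {a : Addr}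
    (ha : m.enode a = none) (k : Key K) :
    Trans t m g (m.newE a k) { g with ecr := Function.update g.ecr a (some t) } ∅ := by
  have hold : ∀ b nb, m.enode b = some nb → (m.newE a k).enode b = some nb := by
    intro b nb hb
    rw [Mem.newE, Mem.setE_enode, if_neg (by rintro rfl; simp [ha] at hb)]
    exact hb
  have hoa : g.own a = none := by
    by_contra hc
    obtain ⟨w, hw⟩ := Option.ne_none_iff_exists'.1 hc
    obtain ⟨⟨n, h⟩, -⟩ := G.e_alloc _ _ hw
    simp [ha] at h
  have hbwd : ∀ b nb, (m.newE a k).enode b = some nb → (b = a ∧ nb = ⟨k, none, .transit, none⟩) ∨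
      m.enode b = some nb := by
    intro b nb hb
    rw [Mem.newE, Mem.setE_enode] at hb
    split_ifs at hb with h
    · exact .inl ⟨h, by simpa using hb.symm⟩
    · exact .inr hb
  have hkeep : ∀ x y, m.EReach x y → (m.newE a k).EReach x y := by
    intro x y h
    rw [Mem.eReach_eq] at h ⊢
    rw [Mem.newE, Mem.enx_setE]
    exact h.update_none (by simp [Mem.enx, ha]) _
  have hownE : ∀ e n w, g.own e = some w → (m.newE a k).enode e = some n → m.enode e = some n := by
    intro e n w h₁ h₂
    rcases hbwd _ _ h₂ with ⟨rfl, -⟩ | h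
    · simp [hoa] at h₁
    · exact h
  refine ⟨⟨G.v_alloc, G.v_head, G.v_bot, G.v_next, G.v_reach, G.v_lock, G.v_cr, ?_, ?_, ?_, ?_, ?_,
    ?_, ?_, ?_⟩, ?_, ⟨fun _ _ _ _ _ => id, fun x y _ _ _ => hkeep x y⟩, ?_⟩
  · intro b nb hb
    obtain ⟨h₁, nh, h₂, h₃⟩ := G.v_edge b nb hb
    exact ⟨h₁, nh, hold _ _ h₂, h₃⟩
  · intro e w h
    obtain ⟨⟨ne, h₁⟩, h₂⟩ := G.e_alloc e w h
    exact ⟨⟨ne, hold _ _ h₁⟩, h₂⟩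
  · intro e n f h₁ h₂
    rcases hbwd _ _ h₁ with ⟨-, rfl⟩ | h
    · simp at h₂
    · obtain ⟨n', h₃, h₄⟩ := G.e_next _ _ _ h h₂
      exact ⟨n', hold _ _ h₃, h₄⟩
  · exact fun e n f w h₁ h₂ h₃ => G.e_own _ _ _ _ h₁ (hownE _ _ _ h₁ h₂) h₃
  · exact fun e n w h₁ h₂ h₃ => G.e_last _ _ _ h₁ (hownE _ _ _ h₁ h₂) h₃
  · exact fun e n w v h₁ h₂ h₃ h₄ => hkeep _ _ (G.e_reach _ _ _ _ h₁ h₂ (hownE _ _ _ h₁ h₃) h₄)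
  · intro e n t' h₁ h₂
    rcases hbwd _ _ h₁ with ⟨-, rfl⟩ | h
    · simp at h₂
    · exact G.e_lock _ _ _ h h₂
  · intro e t' h
    by_cases he : e = a
    · subst he
      exact ⟨_, by rw [Mem.newE, Mem.setE_enode, if_pos rfl]⟩
    · obtain ⟨n, h⟩ := G.e_cr e t' (by simpa [Function.update_of_ne he] using h)
      exact ⟨n, hold _ _ h⟩
  · intro t' ht
    refine ⟨fun _ => id, fun _ _ => id, ?_, (Rely.refl t' m g).vnode, ?_,
      (Rely.refl t' m g).vpriv, ?_⟩
    · intro e he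
      obtain ⟨n, h⟩ := G.e_cr e t' he
      have hne : e ≠ a := by rintro rfl; simp [ha] at h
      simpa [Function.update_of_ne hne] using he
    · exact fun e n h => ⟨n, hold _ _ h, rfl, fun h => ⟨h, rfl, id, id⟩, id, fun _ => id⟩
    · intro e he he'
      obtain ⟨n, h⟩ := G.e_cr e t' he
      exact ⟨he', by rw [h, hold _ _ h]⟩
  · rintro τ ⟨h₁, h₂, h₃, n, h₄, h₅⟩
    exact .inl ⟨h₁, h₂, h₃, n, hownE _ _ _ h₃ h₄, h₅⟩

/-- The addresses are fresh, so no old node or path is affected. The sentinels belong to the new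
vertex node from the start and are its only edge nodes, which gives the last clause of `VPriv`. -/
theorem Global.newV_trans (G : Global m g) (t : T) {σ : Status} {a h l : Addr}
    (ha : m.vnode a = none) (hh : m.enode h = none) (hl : m.enode l = none) (hhl : h ≠ l)
    (k : Key K) :
    Trans t m g (m.newV σ a h l k)
      { g with vcr := Function.update g.vcr a (some t)
               own := Function.update (Function.update g.own l (some a)) h (some a) } ∅ ∧
    VPriv (m.newV σ a h l k)
      { g with vcr := Function.update g.vcr a (some t)
               own := Function.update (Function.update g.own l (some a)) h (some a) } t a none := by
  have hown : ∀ e, m.enode e = none → g.own e = none := by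
    intro e he
    by_contra hc
    obtain ⟨w, hw⟩ := Option.ne_none_iff_exists'.1 hc
    obtain ⟨⟨n, h⟩, -⟩ := G.e_alloc _ _ hw
    simp [he] at h
  have hapub : a ∉ g.vp := by
    intro h
    obtain ⟨n, h⟩ := G.v_alloc _ h
    simp [ha] at h
  have hao : ∀ e, g.own e ≠ some a := by
    intro e he
    obtain ⟨-, n, h⟩ := G.e_alloc _ _ he
    simp [ha] at h
  set m' := m.newV σ a h l k with hm'
  set own' := Function.update (Function.update g.own l (some a)) h (some a) with hown'
  have hvn : ∀ b, m'.vnode b = if b = a then some ⟨k, none, h, l, false, none⟩ else m.vnode b := by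
    intro b
    rw [hm', Mem.newV, Mem.setV_vnode]
    rfl
  have hen : ∀ e, m'.enode e = if e = h then some ⟨⊥, some l, σ, none⟩ else
      if e = l then some ⟨⊤, none, σ, none⟩ else m.enode e := by
    intro e
    rw [hm', Mem.newV, Mem.setV_enode, Mem.setE_enode, Mem.setE_enode]
  have hoe : ∀ e, own' e = if e = h then some a else if e = l then some a else g.own e := by
    intro e
    simp [hown', Function.update_apply]
  have vold : ∀ b n, m.vnode b = some n → m'.vnode b = some n := by
    intro b n hb
    rw [hvn, if_neg (by rintro rfl; simp [ha] at hb), hb]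
  have eold : ∀ e n, m.enode e = some n → m'.enode e = some n := by
    intro e n he
    rw [hen, if_neg (by rintro rfl; simp [hh] at he), if_neg (by rintro rfl; simp [hl] at he), he]
  have oold : ∀ e w, g.own e = some w → own' e = some w := by
    intro e w he
    rw [hoe, if_neg (by rintro rfl; simp [hown _ hh] at he),
      if_neg (by rintro rfl; simp [hown _ hl] at he), he]
  have vkeep : ∀ x y, m.VReach x y → m'.VReach x y := fun x y hr =>
    ReflTransGen.mono (fun b c ⟨n, h₁, h₂⟩ => ⟨n, vold _ _ h₁, h₂⟩) _ _ hr
  have ekeep : ∀ x y, m.EReach x y → m'.EReach x y := fun x y hr =>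
    ReflTransGen.mono (fun b c ⟨n, h₁, h₂⟩ => ⟨n, eold _ _ h₁, h₂⟩) _ _ hr
  have ocases : ∀ e w, own' e = some w → (w = a ∧ (e = h ∨ e = l)) ∨ (w ≠ a ∧ e ≠ h ∧ e ≠ l ∧
      g.own e = some w) := by
    intro e w he
    rw [hoe] at he
    split_ifs at he with h₁ h₂
    · exact .inl ⟨by simpa using he.symm, .inl h₁⟩
    · exact .inl ⟨by simpa using he.symm, .inr h₂⟩
    · exact .inr ⟨by rintro rfl; exact hao _ he, h₁, h₂, he⟩
  have eh : m'.enode h = some ⟨⊥, some l, σ, none⟩ := by rw [hen, if_pos rfl]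
  have el : m'.enode l = some ⟨⊤, none, σ, none⟩ := by rw [hen, if_neg hhl.symm, if_pos rfl]
  have va : m'.vnode a = some ⟨k, none, h, l, false, none⟩ := by rw [hvn, if_pos rfl]
  have vne : ∀ b n, b ≠ a → m'.vnode b = some n → m.vnode b = some n := by
    intro b n hb h'
    rwa [hvn, if_neg hb] at h'
  have ene : ∀ e n, e ≠ h → e ≠ l → m'.enode e = some n → m.enode e = some n := by
    intro e n h₁ h₂ h₃
    rwa [hen, if_neg h₁, if_neg h₂] at h₃
  have oh : own' h = some a := by rw [hoe, if_pos rfl]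
  have ol : own' l = some a := by rw [hoe, if_neg hhl.symm, if_pos rfl]
  refine ⟨⟨⟨?_, G.v_head, ?_, ?_, ?_, ?_, ?_, ?_, ?_, ?_, ?_, ?_, ?_, ?_, ?_⟩, ?_,
    ⟨fun x y _ _ _ => vkeep x y, fun x y _ _ _ => ekeep x y⟩, ?_⟩, ?_⟩
  · intro b hb
    obtain ⟨n, h⟩ := G.v_alloc b hb
    exact ⟨n, vold _ _ h⟩
  · obtain ⟨n, h₁, h₂⟩ := G.v_bot
    exact ⟨n, vold _ _ h₁, h₂⟩
  · intro b n c hb hc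
    by_cases hba : b = a
    · subst hba
      obtain rfl := by simpa [va] using hb
      simp at hc
    · obtain ⟨h₁, n', h₂, h₃⟩ := G.v_next _ _ _ (vne _ _ hba hb) hc
      exact ⟨h₁, n', vold _ _ h₂, h₃⟩
  · intro b n hb hn hu
    exact vkeep _ _ (G.v_reach b n hb (vne _ _ (by rintro rfl; exact hapub hb) hn) hu)
  · intro b n t' hb hc
    by_cases hba : b = a
    · subst hba
      obtain rfl := by simpa [va] using hb
      simp at hc
    · exact G.v_lock _ _ _ (vne _ _ hba hb) hc
  · intro b t' hb
    by_cases hba : b = a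
    · subst hba
      exact ⟨_, va⟩
    · obtain ⟨n, h'⟩ := G.v_cr b t' (by simpa [Function.update_of_ne hba] using hb)
      exact ⟨n, vold _ _ h'⟩
  · intro b n hb
    by_cases hba : b = a
    · subst hba
      obtain rfl := by simpa [va] using hb
      exact ⟨oh, _, eh, rfl⟩
    · obtain ⟨h₁, nh, h₂, h₃⟩ := G.v_edge _ _ (vne _ _ hba hb)
      exact ⟨oold _ _ h₁, nh, eold _ _ h₂, h₃⟩
  · intro e w he
    rcases ocases e w he with ⟨rfl, rfl | rfl⟩ | ⟨-, -, -, h₁⟩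
    · exact ⟨⟨_, eh⟩, _, va⟩
    · exact ⟨⟨_, el⟩, _, va⟩
    · obtain ⟨⟨n, h₂⟩, n', h₃⟩ := G.e_alloc e w h₁
      exact ⟨⟨n, eold _ _ h₂⟩, n', vold _ _ h₃⟩
  · intro e n f he hf
    by_cases h₁ : e = h
    · subst h₁
      obtain rfl := by simpa [eh] using he
      obtain rfl : l = f := by simpa using hf
      exact ⟨_, el, bot_lt_top⟩
    by_cases h₂ : e = l
    · subst h₂
      obtain rfl := by simpa [el] using he
      simp at hf
    obtain ⟨n', h₃, h₄⟩ := G.e_next _ _ _ (ene _ _ h₁ h₂ he) hf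
    exact ⟨n', eold _ _ h₃, h₄⟩
  · intro e n f w ho he hf
    rcases ocases e w ho with ⟨rfl, rfl | rfl⟩ | ⟨-, h₁, h₂, h₃⟩
    · obtain rfl := by simpa [eh] using he
      obtain rfl : l = f := by simpa using hf
      exact ol
    · obtain rfl := by simpa [el] using he
      simp at hf
    · exact oold _ _ (G.e_own _ _ _ _ h₃ (ene _ _ h₁ h₂ he) hf)
  · intro e n w ho he hf
    rcases ocases e w ho with ⟨rfl, rfl | rfl⟩ | ⟨-, h₁, h₂, h₃⟩
    · obtain rfl := by simpa [eh] using he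
      simp at hf
    · obtain rfl := by simpa [el] using he
      rfl
    · exact G.e_last _ _ _ h₃ (ene _ _ h₁ h₂ he) hf
  · intro e n w v ho hv he hs
    rcases ocases e w ho with ⟨rfl, rfl | rfl⟩ | ⟨h₀, h₁, h₂, h₃⟩
    · obtain rfl := by simpa [va] using hv
      exact ReflTransGen.refl
    · obtain rfl := by simpa [va] using hv
      exact ReflTransGen.single ⟨_, eh, rfl⟩
    · exact ekeep _ _ (G.e_reach _ _ _ _ h₃ (vne _ _ h₀ hv) (ene _ _ h₁ h₂ he) hs)
  · intro e n t' he hf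
    by_cases h₁ : e = h
    · subst h₁
      obtain rfl := by simpa [eh] using he
      simp at hf
    by_cases h₂ : e = l
    · subst h₂
      obtain rfl := by simpa [el] using he
      simp at hf
    obtain ⟨w, hw⟩ := Option.ne_none_iff_exists'.1 (G.e_lock _ _ _ (ene _ _ h₁ h₂ he) hf)
    simp [oold _ _ hw]
  · intro e t' he
    obtain ⟨n, h₁⟩ := G.e_cr e t' he
    exact ⟨n, eold _ _ h₁⟩
  · intro t' ht
    refine ⟨fun _ => id, oold, fun _ => id, fun b n hb => ⟨n, vold _ _ hb, rfl, fun _ => rfl⟩,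
      fun e n he => ⟨n, eold _ _ he, rfl, fun h => ⟨h, rfl, id, id⟩, id, fun _ => id⟩, ?_, ?_⟩
    · intro b hb hb'
      obtain ⟨n, hn⟩ := G.v_cr b t' hb
      have hba : b ≠ a := by rintro rfl; simp [ha] at hn
      refine ⟨by simpa [Function.update_of_ne hba] using hb, hb', by rw [hn, vold _ _ hn], ?_⟩
      intro e he
      rcases ocases e b he with ⟨h₁, -⟩ | ⟨-, -, -, h₁⟩
      · exact absurd h₁ hba
      · exact h₁
    · intro e he he'
      obtain ⟨n, hn⟩ := G.e_cr e t' he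
      refine ⟨?_, by rw [hn, eold _ _ hn]⟩
      change own' e = none
      rw [hoe, if_neg (by rintro rfl; simp [hh] at hn), if_neg (by rintro rfl; simp [hl] at hn), he']
  · rintro τ ⟨h₁, ⟨n, h₂, h₃⟩, h₄, n', h₅, h₆⟩
    rcases ocases _ _ h₄ with ⟨h₇, -⟩ | ⟨h₇, h₈, h₉, h₁₀⟩
    · exact absurd (h₇ ▸ h₁) hapub
    · exact .inl ⟨h₁, ⟨n, vne _ _ h₇ h₂, h₃⟩, h₁₀, n', ene _ _ h₈ h₉ h₅, h₆⟩
  · refine ⟨by simp, hapub, ⟨_, va, rfl⟩, fun e n ho he => ?_⟩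
    rcases ocases e a ho with ⟨-, rfl | rfl⟩ | ⟨h₀, -⟩
    · obtain rfl := by simpa [eh] using he
      exact .inl rfl
    · obtain rfl := by simpa [el] using he
      exact .inr rfl
    · exact absurd rfl h₀

end New

end ConcGraph

namespace ConcGraph

open PC Relation

variable {T K : Type*}

/-! ### The thread's own assertions across its own writes -/

section Writes

variable {m m' : Mem T K} {g : Ghost T} {t : T}

theorem VLk.get {a : Addr} {P : VNode T K → Prop} {n : VNode T K} (h : VLk m t a P)
    (hn : m.vnode a = some n) : n.lock = some t ∧ P n := by
  obtain ⟨n', h₁, h₂⟩ := h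
  obtain rfl : n = n' := by simpa [hn] using h₁
  exact h₂

theorem VVal.get {a : Addr} {P : Key K → Prop} {n : VNode T K} (h : VVal m a P)
    (hn : m.vnode a = some n) : P n.val := by
  obtain ⟨n', h₁, h₂⟩ := h
  obtain rfl : n = n' := by simpa [hn] using h₁
  exact h₂

theorem EVal.get {a : Addr} {P : Key K → Prop} {n : ENode T K} (h : EVal m a P)
    (hn : m.enode a = some n) : P n.val := by
  obtain ⟨n', h₁, h₂⟩ := h
  obtain rfl : n = n' := by simpa [hn] using h₁
  exact h₂

theorem ELk.get {a : Addr} {n : ENode T K} (h : ELk m t a) (hn : m.enode a = some n) :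
    n.lock = some t := by
  obtain ⟨n', h₁, h₂⟩ := h
  obtain rfl : n = n' := by simpa [hn] using h₁
  exact h₂

theorem ENx.get {a : Addr} {w : Option Addr} {n : ENode T K} (h : ENx m t a w)
    (hn : m.enode a = some n) : n.lock = some t ∧ n.enext = w := by
  obtain ⟨n', h₁, h₂⟩ := h
  obtain rfl : n = n' := by simpa [hn] using h₁
  exact h₂

theorem EValid.get {a : Addr} {mode : EMode} {n : ENode T K} (h : EValid m t a mode)
    (hn : m.enode a = some n) : n.lock = some t ∧ mode.Valid n.status := by
  obtain ⟨n', h₁, h₂⟩ := h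
  obtain rfl : n = n' := by simpa [hn] using h₁
  exact h₂

theorem EMarked.get {a : Addr} {n : ENode T K} (h : EMarked m a)
    (hn : m.enode a = some n) : n.status = .marked := by
  obtain ⟨n', h₁, h₂⟩ := h
  obtain rfl : n = n' := by simpa [hn] using h₁
  exact h₂

theorem VVal.ne {a b : Addr} {P Q : Key K → Prop} (h : VVal m a P) (h' : VVal m b Q)
    (hPQ : ∀ x, P x → ¬ Q x) : a ≠ b := by
  rintro rfl
  obtain ⟨n, hn, hP⟩ := h
  exact hPQ _ hP (h'.get hn)

theorem EVal.ne {a b : Addr} {P Q : Key K → Prop} (h : EVal m a P) (h' : EVal m b Q)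
    (hPQ : ∀ x, P x → ¬ Q x) : a ≠ b := by
  rintro rfl
  obtain ⟨n, hn, hP⟩ := h
  exact hPQ _ hP (h'.get hn)

theorem VLk.imp {a : Addr} {P Q : VNode T K → Prop} (h : VLk m t a P) (hPQ : ∀ n, P n → Q n) :
    VLk m t a Q :=
  Exists.imp (fun n => And.imp id (And.imp id (hPQ n))) h

theorem EValid.eLk {a : Addr} {mode : EMode} : EValid m t a mode → ELk m t a :=
  Exists.imp fun _ => And.imp id And.left

theorem VVal.setV {a b : Addr} {P : Key K → Prop} {n n' : VNode T K} (h : VVal m b P)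
    (hn : m.vnode a = some n) (hv : n'.val = n.val) : VVal (m.setV a n') b P := by
  by_cases hb : b = a
  · subst hb
    exact ⟨n', by simp [Mem.setV_vnode], hv ▸ h.get hn⟩
  · simpa [VVal, Mem.setV_vnode, hb] using h

theorem VLk.setV_ne {a b : Addr} {P : VNode T K → Prop} (h : VLk m t b P) (hb : b ≠ a)
    (n' : VNode T K) : VLk (m.setV a n') t b P := by
  simpa [VLk, Mem.setV_vnode, hb] using h

theorem VLk.setV_self {a : Addr} {P : VNode T K → Prop} {n' : VNode T K} (hl : n'.lock = some t)
    (h : P n') : VLk (m.setV a n') t a P :=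
  ⟨n', by simp [Mem.setV_vnode], hl, h⟩

theorem EVal.setE {a b : Addr} {P : Key K → Prop} {n n' : ENode T K} (h : EVal m b P)
    (hn : m.enode a = some n) (hv : n'.val = n.val) : EVal (m.setE a n') b P := by
  by_cases hb : b = a
  · subst hb
    exact ⟨n', by simp [Mem.setE_enode], hv ▸ h.get hn⟩
  · simpa [EVal, Mem.setE_enode, hb] using h

theorem ELk.setE_ne {a b : Addr} (h : ELk m t b) (hb : b ≠ a) (n' : ENode T K) :
    ELk (m.setE a n') t b := by
  simpa [ELk, Mem.setE_enode, hb] using h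

theorem ENx.setE_ne {a b : Addr} {w : Option Addr} (h : ENx m t b w) (hb : b ≠ a)
    (n' : ENode T K) : ENx (m.setE a n') t b w := by
  simpa [ENx, Mem.setE_enode, hb] using h

theorem EValid.setE_ne {a b : Addr} {mode : EMode} (h : EValid m t b mode) (hb : b ≠ a)
    (n' : ENode T K) : EValid (m.setE a n') t b mode := by
  simpa [EValid, Mem.setE_enode, hb] using h

theorem ELk.setE_self {a : Addr} {n' : ENode T K} (hl : n'.lock = some t) :
    ELk (m.setE a n') t a :=
  ⟨n', by simp [Mem.setE_enode], hl⟩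

theorem EMine.setE {a b : Addr} {n n' : ENode T K} (h : EMine m g t b)
    (hn : m.enode a = some n) (hs : n'.status = n.status) : EMine (m.setE a n') g t b := by
  obtain ⟨h₀, nb, h₁, h₂⟩ := h
  by_cases hb : b = a
  · subst hb
    obtain rfl : n = nb := by simpa [hn] using h₁
    exact ⟨h₀, n', by simp [Mem.setE_enode], hs.trans h₂⟩
  · exact ⟨h₀, nb, by simpa [Mem.setE_enode, hb] using h₁, h₂⟩

theorem Own.setE {k₂ : Key K} {v₁ e₃ a : Addr} {n n' : ENode T K} (h : Own m g t k₂ v₁ e₃)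
    (hn : m.enode a = some n) (hv : n'.val = n.val) (hs : n'.status = n.status) :
    Own (m.setE a n') g t k₂ v₁ e₃ :=
  ⟨h.1.setE hn hs, h.2.1, h.2.2.setE hn hv⟩

end Writes

/-! ### Exploration along a cyclic set -/

section Search

variable {m : Mem T K} {g : Ghost T} {S : Set (Arc K)} {R X : Set (Key K)}

theorem Present.unmarked {τ : Arc K} (h : Present m g τ) {n : ENode T K}
    (hn : m.enode τ.e = some n) : n.val = Key.of τ.v ∧ n.status ≠ .marked := by
  obtain ⟨-, -, -, n', h₁, h₂⟩ := h
  obtain rfl : n = n' := by simpa [hn] using h₁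
  exact h₂

theorem Explored.mono {R' : Set (Key K)} {b x : Key K}
    (h : Explored S R X b x) (hR : R ⊆ R') : Explored S R' X b x :=
  ⟨fun x hx y hy => hR (h.1 x hx y hy), h.2⟩

theorem Explored.insert {b x : Key K}
    (h : Explored S R X b x) (hx : ∀ τ ∈ S, Key.of τ.u = x → Key.of τ.v ∈ R) :
    (∀ y ∈ insert x X, ∀ z, ArcRel S y z → z ∈ R) ∧ b ∈ insert x X := by
  refine ⟨?_, ?_⟩
  · rintro y (rfl | hy) z hz
    · obtain ⟨τ, hτ, h₁, rfl⟩ := hz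
      exact hx τ hτ h₁
    · exact h.1 y hy z hz
  · rcases h.2 with h | rfl
    · exact .inr h
    · exact .inl rfl

/-- A complete exploration from `b` reaches the source of every arc from `a` to `b` on a cycle. -/
theorem mem_of_explored {S : Set (Arc K)} (hS : Cyclic S) {R X : Set (Key K)}
    (hX : ∀ x ∈ X, ∀ y, ArcRel S x y → y ∈ R) (hR : R ⊆ X) {τ : Arc K} (hτ : τ ∈ S)
    (hb : Key.of τ.v ∈ X) : Key.of τ.u ∈ R := by
  have key : ∀ y, ReflTransGen (ArcRel S) (Key.of τ.v) y → y ∈ X := by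
    intro y h
    induction h with
    | refl => exact hb
    | tail _ h ih => exact hR (hX _ ih _ h)
  -- Being explored is not enough, since the start key of a search is never put into `R` as such;
  -- the last arc into the source of `τ` puts it there. If the path is trivial, `τ` is a loop and is
  -- itself that arc.
  rcases ReflTransGen.cases_tail (hS τ hτ) with h | ⟨y, h₁, h₂⟩
  · exact hX _ hb _ ⟨τ, hτ, h, h.symm⟩
  · exact hX _ (key y h₁) _ h₂

end Search

variable [LinearOrder K]

section Writes

variable {m m' : Mem T K} {g g' : Ghost T} {t : T}

theorem VWin.setV {k : Key K} {v₁ v₂ a : Addr} {n n' : VNode T K} (h : VWin m g k v₁ v₂)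
    (hn : m.vnode a = some n) (hv : n'.val = n.val) : VWin (m.setV a n') g k v₁ v₂ :=
  ⟨h.1, h.2.1, h.2.2.1, h.2.2.2.1.setV hn hv, h.2.2.2.2.setV hn hv⟩

theorem VWin.ne {k : Key K} {v₁ v₂ : Addr} (h : VWin m g k v₁ v₂) : v₁ ≠ v₂ :=
  h.2.2.2.1.ne h.2.2.2.2 fun _ => not_le_of_gt

theorem VGap.ne {k : Key K} {v₁ v₂ : Addr} (h : VGap m g t k v₁ v₂) : v₁ ≠ v₂ :=
  h.2.2.1.ne h.2.2.2.1 fun _ => not_lt_of_gt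

theorem Win.setE {k₂ : Key K} {v₁ e₁ e₂ a : Addr} {n n' : ENode T K} (h : Win m g k₂ v₁ e₁ e₂)
    (hn : m.enode a = some n) (hv : n'.val = n.val) : Win (m.setE a n') g k₂ v₁ e₁ e₂ :=
  ⟨h.1, h.2.1, h.2.2.1.setE hn hv, h.2.2.2.setE hn hv⟩

theorem Win.ne {k₂ : Key K} {v₁ e₁ e₂ : Addr} (h : Win m g k₂ v₁ e₁ e₂) : e₁ ≠ e₂ :=
  h.2.2.1.ne h.2.2.2 fun _ => not_le_of_gt

theorem EGap.ne {k₂ : Key K} {v₁ e₁ e₂ : Addr} (h : EGap m g t k₂ v₁ e₁ e₂) : e₁ ≠ e₂ :=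
  h.2.2.1.ne h.2.2.2.1 fun _ => not_lt_of_gt

theorem Loc.setE {mode : EMode} {k₁ k₂ : Key K} {v₁ a : Addr} {n n' : ENode T K}
    (h : Loc m g t mode k₁ k₂ v₁) (hn : m.enode a = some n) (hv : n'.val = n.val)
    (hs : n'.status = n.status) : Loc (m.setE a n') g t mode k₁ k₂ v₁ := by
  refine ⟨h.1, ?_⟩
  cases mode
  · trivial
  · trivial
  · exact Own.setE h.2 hn hv hs

theorem Ctx.setE {c : AddCtx K} {a : Addr} {n n' : ENode T K} (h : Ctx m g t c)
    (hn : m.enode a = some n) (hv : n'.val = n.val) (hs : n'.status = n.status) :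
    Ctx (m.setE a n') g t c :=
  ⟨h.1, h.2.setE hn hv hs⟩

theorem VGap.mono {k : Key K} {v₁ v₂ : Addr} (h : VGap m g t k v₁ v₂)
    (hm : ∀ b n, m.vnode b = some n → m'.vnode b = some n) (hg : g'.vp = g.vp) :
    VGap m' g' t k v₁ v₂ := by
  obtain ⟨h₁, h₂, ⟨n₁, h₃, h₄⟩, ⟨n₂, h₅, h₆⟩, ⟨n₃, h₇, h₈⟩, n₄, h₉, h₁₀⟩ := h
  exact ⟨hg ▸ h₁, hg ▸ h₂, ⟨n₁, hm _ _ h₃, h₄⟩, ⟨n₂, hm _ _ h₅, h₆⟩, ⟨n₃, hm _ _ h₇, h₈⟩, n₄,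
    hm _ _ h₉, h₁₀⟩

theorem EGap.setE_ne {k₂ : Key K} {v₁ e₁ e₂ a : Addr} (h : EGap m g t k₂ v₁ e₁ e₂)
    (ha : g.own a = none) (n : ENode T K) (hg : g'.own = g.own) :
    EGap (m.setE a n) g' t k₂ v₁ e₁ e₂ := by
  obtain ⟨h₁, h₂, h₃, h₄, h₅, h₆, h₇⟩ := h
  have hne₁ : e₁ ≠ a := by rintro rfl; simp [ha] at h₁
  have hne₂ : e₂ ≠ a := by rintro rfl; simp [ha] at h₂
  refine ⟨hg ▸ h₁, hg ▸ h₂, ?_, ?_, h₅.setE_ne hne₁ _, h₆.setE_ne hne₁ _, h₇.setE_ne hne₂ _⟩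
  · simpa [EVal, Mem.setE_enode, hne₁] using h₃
  · simpa [EVal, Mem.setE_enode, hne₂] using h₄

end Writes

/-! ### Every atomic step preserves the invariants -/

/-- The step from `m, p` to `m', p'` of thread `t` preserves all invariants. -/
def Outcome (t : T) (m : Mem T K) (g : Ghost T) (p : PC K) (m' : Mem T K) (p' : PC K) : Prop :=
  ∃ g' N, Trans t m g m' g' N ∧ Local m' g' t p' ∧
    ∀ S : Set (Arc K), Cyclic S → (∀ τ ∈ S, Present m' g' τ) →
      ((∀ τ ∈ S, Present m g τ) → Detects m S p → Detects m' S p') ∧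
      ((∃ τ ∈ S, τ.e ∈ N) → Detects m' S p')

section Outcome

variable {m m' : Mem T K} {g g' : Ghost T} {t : T} {p p' : PC K}

theorem Outcome.of_trans' (hT : Trans t m g m' g' ∅) (hL : Local m' g' t p')
    (hD : ∀ S : Set (Arc K), Cyclic S → (∀ τ ∈ S, Present m' g' τ) → (∀ τ ∈ S, Present m g τ) →
      Detects m S p → Detects m' S p') : Outcome t m g p m' p' :=
  ⟨g', ∅, hT, hL, fun S hS hP => ⟨hD S hS hP, fun ⟨_, _, h⟩ => h.elim⟩⟩

theorem Outcome.of_trans (hT : Trans t m g m' g' ∅) (hL : Local m' g' t p')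
    (hD : ∀ S : Set (Arc K), Detects m S p → Detects m' S p') : Outcome t m g p m' p' :=
  .of_trans' hT hL fun S _ _ _ => hD S

theorem Outcome.of_read' (G : Global m g) (hL : Local m g t p')
    (hD : ∀ S : Set (Arc K), Cyclic S → (∀ τ ∈ S, Present m g τ) →
      Detects m S p → Detects m S p') : Outcome t m g p m p' :=
  .of_trans' (G.trans_refl t) hL fun S hS hP _ => hD S hS hP

theorem Outcome.of_read (G : Global m g) (hL : Local m g t p')
    (hD : ∀ S : Set (Arc K), Detects m S p → Detects m S p') : Outcome t m g p m p' :=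
  .of_read' G hL fun S _ _ => hD S

end Outcome

theorem Key.bot_lt_of (k : K) : ⊥ < Key.of k := WithBot.bot_lt_coe _

theorem Key.of_lt_top (k : K) : Key.of k < ⊤ := WithBot.coe_lt_coe.2 (WithTop.coe_lt_top k)

section Search

variable {m : Mem T K} {g : Ghost T} {t : T}

/-- The validated place of an undo is that of the thread's own edge node. -/
theorem undo_eq (G : Global m g) {e₃ v₁ e₁ e₂ : Addr} {k₁ k₂ : Key K}
    (hL : Loc m g t (.undo e₃) k₁ k₂ v₁) (hW : Win m g k₂ v₁ e₁ e₂)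
    (hV : EValid m t e₁ (.undo e₃)) (hN : ENx m t e₁ (some e₂)) : e₃ = e₂ := by
  obtain ⟨-, ⟨-, n₃, h₃, hs₃⟩, ho₃, hv₃⟩ := hL
  obtain ⟨ho₁, ho₂, hv₁, n₂, h₂, hle⟩ := hW
  obtain ⟨n₁, h₁, -, hs₁⟩ := hV
  have hn₁ := (hN.get h₁).2
  obtain ⟨-, nv, hv⟩ := G.e_alloc _ _ ho₁
  -- Both `e₁` and `e₃` are unmarked nodes of the list of `v₁`, hence on the one path from its head.
  -- Since the key of `e₁` is smaller, `e₁` comes first.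
  have r₁ := G.e_reach _ _ _ _ ho₁ hv h₁ hs₁
  have r₃ := G.e_reach _ _ _ _ ho₃ hv h₃ (by simp [hs₃])
  have hlt : n₁.val < k₂ := hv₁.get h₁
  have hk : n₃.val = k₂ := hv₃.get h₃
  have hne : e₁ ≠ e₃ := by
    rintro rfl
    obtain rfl : n₁ = n₃ := by simpa [h₁] using h₃
    exact hlt.ne hk
  have r : m.EReach e₁ e₃ := by
    rw [Mem.eReach_eq] at r₁ r₃
    rcases r₁.total r₃ with r | r
    · rwa [Mem.eReach_eq]
    · rw [← Mem.eReach_eq] at r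
      rcases G.eReach_lt r h₃ h₁ with h | h
      · exact absurd h.symm hne
      · rw [hk] at h
        exact absurd hlt h.asymm
  rw [Mem.eReach_eq] at r
  rcases r.cases with h | ⟨z, hz, r⟩
  · exact absurd h hne
  · obtain rfl : e₂ = z := by simpa [Mem.enx, h₁, hn₁] using hz
    rw [← Mem.eReach_eq] at r
    -- The path from `e₁` to `e₃` passes through `e₂`. If `e₃` came strictly later, the key of `e₂`
    -- would be below `k₂`.
    rcases G.eReach_lt r h₂ h₃ with h | h
    · exact h.symm
    · rw [hk] at h
      exact absurd h hle.not_gt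

/-- Owner and key of `e₃` determine both ends of its arc, so the search from `k₂` for `k₁` is the
right one for the set `S`. -/
theorem HasE.keys {S : Set (Arc K)} {c : AddCtx K} (h : HasE S c.e₃) (hC : Ctx m g t c)
    (hP : ∀ τ ∈ S, Present m g τ) : ∃ τ ∈ S, Key.of τ.u = c.k₁ ∧ Key.of τ.v = c.k₂ := by
  obtain ⟨τ, hτ, he⟩ := h
  obtain ⟨-, ⟨nw, h₁, h₂, -⟩, h₃, ne, h₄, h₅, -⟩ := hP τ hτ
  obtain ⟨⟨-, hv, -⟩, -, ho, he'⟩ := hC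
  rw [he] at h₃ h₄
  rw [ho] at h₃
  have hw : τ.w = c.v₁ := by simpa using h₃.symm
  rw [hw] at h₁
  exact ⟨τ, hτ, by rw [← h₂, hv.get h₁], by rw [← h₅, he'.get h₄]⟩

theorem Present.vReach {τ : Arc K} (G : Global m g) (h : Present m g τ) :
    m.VReach vertexHead τ.w := by
  obtain ⟨h₁, ⟨n, h₂, -, h₃⟩, -⟩ := h
  exact G.v_reach _ _ h₁ h₂ h₃

/-- A search of the vertex list that has not passed `τ.w` finds it. -/
theorem Present.eq_of_vReach {τ : Arc K} (G : Global m g) (h : Present m g τ) {v : Addr}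
    {n : VNode T K} (hn : m.vnode v = some n) (hr : m.VReach v τ.w) :
    v = τ.w ∨ n.val < Key.of τ.u := by
  obtain ⟨-, ⟨n', h₂, h₃, -⟩, -⟩ := h
  exact h₃ ▸ G.vReach_lt hr hn h₂

end Search

/-- The assertion at each program point supplies the hypotheses of the lemma for the access in
question. Cyclicity of `S` is used at a single step, the end of an unsuccessful search. -/
theorem ThreadStep.outcome {σ : Status} {t : T} {m m' : Mem T K} {g : Ghost T} {p p' : PC K}
    (h : ThreadStep σ t m p m' p') (G : Global m g) (hL : Local m g t p) :
    Outcome t m g p m' p' := by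
  cases h with
  | callAddVertex k => exact .of_read G (Key.bot_lt_of k) fun _ => id
  | callRemoveVertex k => exact .of_read G (Key.bot_lt_of k) fun _ => id
  | callContainsVertex k => exact .of_read G trivial fun _ => id
  | callEdge op k₁ k₂ swap =>
    exact .of_read G ⟨G.v_head, Key.bot_lt_of k₂, Key.of_lt_top k₂⟩ fun _ => id
  | respond b => exact .of_read G trivial fun _ => id
  | cvNext => exact .of_read G trivial fun _ => id
  | cvAbsent => exact .of_read G trivial fun _ => id
  | cvFound => exact .of_read G trivial fun _ => id
  | vlStart op k n w hn hw =>
    refine .of_read G ⟨hL, G.v_head, (G.v_next _ _ _ hn hw).1, ?_⟩ fun _ => id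
    obtain ⟨n', h₁, h₂⟩ := G.v_bot
    exact ⟨n', h₁, h₂ ▸ hL⟩
  | vlNext op k v₁ v₂ n w hn hlt hw =>
    exact .of_read G ⟨hL.1, hL.2.2.1, (G.v_next _ _ _ hn hw).1, n, hn, hlt⟩ fun _ => id
  | vlStop op k v₁ v₂ n hn hle =>
    exact .of_read G ⟨hL.1, hL.2.1, hL.2.2.1, hL.2.2.2, n, hn, hle⟩ fun _ => id
  | vlLock₁ op k v₁ v₂ n hn hl =>
    exact .of_trans (G.lockV_trans hn (.inl hl) hL.2.1 _) ⟨hL.setV hn rfl, .setV_self rfl trivial⟩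
      fun _ => id
  | vlLock₂ op k v₁ v₂ n hn hl =>
    exact .of_trans (G.lockV_trans hn (.inl hl) hL.1.2.2.1 _)
      ⟨hL.1.setV hn rfl, hL.2.setV_ne hL.1.ne _, .setV_self rfl trivial⟩ fun _ => id
  | vlCheck₁_ok op k v₁ v₂ n hn hm =>
    exact .of_read G ⟨hL.1, ⟨n, hn, (hL.2.1.get hn).1, hm⟩, hL.2.2⟩ fun _ => id
  | vlCheck₁_fail => exact .of_read G hL fun _ => id
  | vlCheck₂_ok => exact .of_read G hL fun _ => id
  | vlCheck₂_fail =>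
    exact .of_read G ⟨hL.1, hL.2.1.imp fun _ _ => trivial, hL.2.2⟩ fun _ => id
  | vlCheck₃_ok op k v₁ v₂ n hn hx =>
    exact .of_read G ⟨hL.1, ⟨n, hn, (hL.2.1.get hn).1, (hL.2.1.get hn).2, hx⟩, hL.2.2⟩ fun _ => id
  | vlCheck₃_fail =>
    exact .of_read G ⟨hL.1, hL.2.1.imp fun _ _ => trivial, hL.2.2⟩ fun _ => id
  | vlFail₁ op k v₁ v₂ n hn =>
    exact .of_trans (G.unlockV_trans hn (hL.2.1.get hn).1)
      ⟨hL.1.1, hL.2.2.setV_ne hL.1.ne.symm _⟩ fun _ => id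
  | vlFail₂ op k v₂ n hn =>
    exact .of_trans (G.unlockV_trans hn (hL.2.get hn).1) hL.1 fun _ => id
  | avAbsent k v₁ v₂ n hn hv =>
    obtain ⟨⟨-, h₁, h₂, h₃, h₄⟩, h₅, h₆⟩ := hL
    exact .of_read G ⟨h₁, h₂, h₃, ⟨n, hn, lt_of_le_of_ne (h₄.get hn) hv.symm⟩, h₅, h₆⟩ fun _ => id
  | avPresent =>
    exact .of_read G ⟨hL.1.ne, hL.2.1.imp fun _ _ => trivial, hL.2.2⟩ fun _ => id
  | avNew k v₁ v₂ v₃ h l hv hh hl hhl =>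
    obtain ⟨hT, hp⟩ := G.newV_trans t (σ := σ) hv hh hl hhl k
    refine .of_trans hT ⟨k, VGap.mono hL (fun b n hb => ?_) rfl,
      ⟨⟨k, none, h, l, false, none⟩, ?_, rfl⟩, hp⟩ fun _ => id
    · rw [Mem.newV, Mem.setV_vnode, if_neg (by rintro rfl; simp [hv] at hb)]
      exact hb
    · rw [Mem.newV, Mem.setV_vnode, if_pos rfl]
  | avLink v₁ v₂ v₃ n hn =>
    obtain ⟨k, ⟨h₁, h₂, h₃, h₄, h₅, h₆⟩, hk, hp⟩ := hL
    obtain ⟨n₂, hn₂, hlt⟩ := h₄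
    have hk' : n.val = k := hk.get hn
    refine .of_trans (G.linkV_trans hn hp h₂ hn₂ (hk' ▸ hlt)) ⟨k, ⟨h₁, h₂, h₃.setV hn rfl,
      VVal.setV ⟨n₂, hn₂, hlt⟩ hn rfl, h₅.setV_ne ?_ _, h₆.setV_ne ?_ _⟩, hk.setV hn rfl, hp.1,
      hp.2.1, ⟨_, by rw [Mem.setV_vnode, if_pos rfl], rfl⟩, hp.2.2.2⟩ fun _ => id
    · rintro rfl
      exact hp.2.1 h₁
    · rintro rfl
      exact hp.2.1 h₂
  | avPublish v₁ v₂ v₃ n hn =>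
    obtain ⟨k, hG, hk, hp⟩ := hL
    obtain ⟨hl, hu, hx⟩ := hG.2.2.2.2.1.get hn
    obtain ⟨n₃, hn₃, hk'⟩ := hk
    have hlt : n.val < n₃.val := hk' ▸ hG.2.2.1.get hn
    exact .of_trans (G.publishV_trans hn hl hu hx hp hn₃ hlt)
      ⟨hG.ne, .setV_self hl trivial, hG.2.2.2.2.2.setV_ne hG.ne.symm _⟩ fun _ => id
  | rvPresent =>
    exact .of_read G ⟨hL.1.ne, hL.2.1.imp fun _ => And.right, hL.2.2⟩ fun _ => id
  | rvAbsent =>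
    exact .of_read G ⟨hL.1.ne, hL.2.1.imp fun _ _ => trivial, hL.2.2⟩ fun _ => id
  | rvMark v₁ v₂ n hn =>
    have hl := (hL.2.2.get hn).1
    exact .of_trans (G.markV_trans hn hl) ⟨hL.1, hL.2.1.setV_ne hL.1 _, .setV_self hl rfl⟩
      fun _ => id
  | rvRead v₁ v₂ n hn =>
    exact .of_read G ⟨hL.1, hL.2.1, n, hn, (hL.2.2.get hn).1, (hL.2.2.get hn).2, rfl⟩ fun _ => id
  | rvUnlink v₁ v₂ w n hn =>
    obtain ⟨hne, h₁, n₂, hn₂, hl₂, hm, rfl⟩ := hL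
    obtain ⟨hl, hx⟩ := h₁.get hn
    exact .of_trans (G.unlinkV_trans hn hl hx hn₂ hm)
      ⟨hne, .setV_self hl trivial, VLk.setV_ne ⟨n₂, hn₂, hl₂, trivial⟩ hne.symm _⟩ fun _ => id
  | vUnlock₁ v₁ v₂ b n hn =>
    exact .of_trans (G.unlockV_trans hn (hL.2.1.get hn).1) (hL.2.2.setV_ne hL.1.symm _) fun _ => id
  | vUnlock₂ v₂ b n hn =>
    exact .of_trans (G.unlockV_trans hn (VLk.get hL hn).1) trivial fun _ => id
  | hsFirstNext op k₁ k₂ swap v n w hn hlt hw =>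
    exact .of_read G ⟨(G.v_next _ _ _ hn hw).1, hL.2⟩ fun _ => id
  | hsFirstFound op k₁ k₂ swap v n hn hv hm =>
    exact .of_read G ⟨hL.1, ⟨n, hn, hv⟩, hL.2⟩ fun _ => id
  | hsFirstAbsent => exact .of_read G trivial fun _ => id
  | hsNextSucc op k₁ k₂ swap w n v hn hv =>
    exact .of_read G ⟨hL.1, hL.2.1, (G.v_next _ _ _ hn hv).1, hL.2.2⟩ fun _ => id
  | hsNextHead => exact .of_read G ⟨hL.1, hL.2.1, G.v_head, hL.2.2⟩ fun _ => id
  | hsSecondNext op k₁ k₂ swap w v n v' hn hlt hw =>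
    exact .of_read G ⟨hL.1, hL.2.1, (G.v_next _ _ _ hn hw).1, hL.2.2.2⟩ fun _ => id
  | hsSecondFound op k₁ k₂ swap w v n hn hv hm =>
    obtain ⟨h₁, h₂, h₃, h₄⟩ := hL
    refine .of_read G ?_ fun _ => id
    cases swap
    · exact ⟨h₁, h₂, h₄⟩
    · exact ⟨h₃, ⟨n, hn, hv⟩, h₄⟩
  | hsSecondAbsent => exact .of_read G trivial fun _ => id
  | hsDoneAdd => exact .of_read G ⟨hL, trivial⟩ fun _ => id
  | hsDoneRemove => exact .of_read G ⟨hL, trivial⟩ fun _ => id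
  | hsDoneContains => exact .of_read G trivial fun _ => id
  | ceNext => exact .of_read G trivial fun _ => id
  | ceTrue => exact .of_read G trivial fun _ => id
  | ceFalse => exact .of_read G trivial fun _ => id
  | leMarked₁_ok => exact .of_read G hL fun _ => id
  | leMarked₁_fail => exact .of_read G trivial fun _ => id
  | leMarked₂_ok => exact .of_read G hL fun _ => False.elim
  | leMarked₂_fail => exact .of_read G trivial fun _ => id
  | elStart mode k₁ k₂ v₁ n h w hn hh hw =>
    obtain ⟨h₁, nh, h₂, h₃⟩ := G.v_edge _ _ hn
    exact .of_read G ⟨hL, h₁, G.e_own _ _ _ _ h₁ hh hw, nh, h₂, h₃ ▸ hL.1.2.2.1⟩ fun _ => id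
  | elNext mode k₁ k₂ v₁ e₁ e₂ n w hn hlt hw =>
    exact .of_read G ⟨hL.1, hL.2.2.1, G.e_own _ _ _ _ hL.2.2.1 hn hw, n, hn, hlt⟩ fun _ => id
  | elStop mode k₁ k₂ v₁ e₁ e₂ n hn hle =>
    exact .of_read G ⟨hL.1, hL.2.1, hL.2.2.1, hL.2.2.2, n, hn, hle⟩ fun _ => id
  | elLock₁ mode k₁ k₂ v₁ e₁ e₂ n hn hl =>
    exact .of_trans (G.lockE_trans hn (.inl hl) (by simp [hL.2.1]) _)
      ⟨hL.1.setE hn rfl rfl, hL.2.setE hn rfl, .setE_self rfl⟩ fun _ => id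
  | elLock₂ mode k₁ k₂ v₁ e₁ e₂ n hn hl =>
    exact .of_trans (G.lockE_trans hn (.inl hl) (by simp [hL.2.1.2.1]) _)
      ⟨hL.1.setE hn rfl rfl, hL.2.1.setE hn rfl, hL.2.2.setE_ne hL.2.1.ne _, .setE_self rfl⟩
      fun _ => id
  | elCheck₁_ok mode k₁ k₂ v₁ e₁ e₂ n hn hv =>
    exact .of_read G ⟨hL.1, hL.2.1, ⟨n, hn, hL.2.2.1.get hn, hv⟩, hL.2.2.2⟩ fun _ => id
  | elCheck₁_fail => exact .of_read G hL fun _ => id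
  | elCheck₂_ok mode k₁ k₂ v₁ e₁ e₂ n hn hv =>
    exact .of_read G ⟨hL.1, hL.2.1, hL.2.2.1, n, hn, hL.2.2.2.get hn, hv⟩ fun _ => id
  | elCheck₂_fail => exact .of_read G ⟨hL.1, hL.2.1, hL.2.2.1.eLk, hL.2.2.2⟩ fun _ => id
  | elCheck₃_ok mode k₁ k₂ v₁ e₁ e₂ n hn hx =>
    exact .of_read G ⟨hL.1, hL.2.1, hL.2.2.1, hL.2.2.2, n, hn, (hL.2.2.1.get hn).1, hx⟩ fun _ => id
  | elCheck₃_fail => exact .of_read G ⟨hL.1, hL.2.1, hL.2.2.1.eLk, hL.2.2.2.eLk⟩ fun _ => id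
  | elFail₁ mode k₁ k₂ v₁ e₁ e₂ n hn =>
    exact .of_trans (G.unlockE_trans hn (hL.2.2.1.get hn))
      ⟨hL.1.setE hn rfl rfl, hL.2.2.2.setE_ne hL.2.1.ne.symm _⟩ fun _ => id
  | elFail₂ mode k₁ k₂ v₁ e₂ n hn =>
    exact .of_trans (G.unlockE_trans hn (hL.2.get hn)) (hL.1.setE hn rfl rfl) fun _ => id
  | aePresent =>
    exact .of_read G ⟨hL.2.1.ne, hL.2.2.1.eLk, hL.2.2.2.1.eLk⟩ fun _ => False.elim
  | aeAbsent k₁ k₂ v₁ e₁ e₂ n hn hv =>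
    obtain ⟨h₀, ⟨h₁, h₂, h₃, h₄⟩, h₅, h₆, h₇⟩ := hL
    exact .of_read G ⟨h₀.1, h₁, h₂, h₃, ⟨n, hn, lt_of_le_of_ne (h₄.get hn) (Ne.symm hv)⟩, h₅, h₇,
      h₆.eLk⟩ fun _ => False.elim
  | aeNew k₁ k₂ v₁ e₁ e₂ e₃ he =>
    have ho : g.own e₃ = none := by
      by_contra hc
      obtain ⟨w, hw⟩ := Option.ne_none_iff_exists'.1 hc
      obtain ⟨⟨n, h⟩, -⟩ := G.e_alloc _ _ hw
      simp [he] at h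
    have hm : (m.newE e₃ k₂).enode e₃ = some ⟨k₂, none, .transit, none⟩ := by
      rw [Mem.newE, Mem.setE_enode, if_pos rfl]
    exact .of_trans (G.newE_trans t he k₂) ⟨hL.1, hL.2.setE_ne ho _ rfl, ⟨_, hm, rfl⟩, by simp, ho,
      _, hm, rfl, rfl⟩ fun _ => id
  | aeLink c e₁ e₂ n hn =>
    obtain ⟨h₁, h₂, h₃, h₄⟩ := hL
    obtain ⟨n₂, hn₂, hlt⟩ := h₂.2.2.2.1
    have hk : n.val = c.k₂ := h₃.get hn
    have hs : n.status = .transit := by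
      obtain ⟨-, -, n', h₅, -, h₆⟩ := h₄
      obtain rfl : n = n' := by simpa [hn] using h₅
      exact h₆
    have hm : (m.setE c.e₃ { n with enext := some e₂ }).enode c.e₃ =
        some { n with enext := some e₂ } := by
      rw [Mem.setE_enode, if_pos rfl]
    exact .of_trans (G.linkE_trans hn h₄ hn₂ (hk ▸ hlt)) ⟨h₁, h₂.setE_ne h₄.2.1 _ rfl,
      h₃.setE hn rfl, h₄.1, h₄.2.1, _, hm, rfl, hs⟩ fun _ => id
  | aePublish c e₁ e₂ n hn =>
    obtain ⟨h₁, h₂, ⟨n₃, hn₃, hk⟩, h₄⟩ := hL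
    obtain ⟨hl, hs⟩ := h₂.2.2.2.2.1.get hn
    have hx := (h₂.2.2.2.2.2.1.get hn).2
    have hlt : n.val < n₃.val := hk ▸ h₂.2.2.1.get hn
    have hs₃ : n₃.status = .transit := by
      obtain ⟨-, -, n', h₅, -, h₆⟩ := h₄
      obtain rfl : n₃ = n' := by simpa [hn₃] using h₅
      exact h₆
    have hne : c.e₃ ≠ e₁ := fun h => by simpa [h, h₂.1] using h₄.2.1
    have hm : (m.setE e₁ { n with enext := some c.e₃ }).enode c.e₃ = some n₃ := by
      rw [Mem.setE_enode, if_neg hne, hn₃]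
    -- Every cyclic set containing the new arc gets this thread as its detector. The other sets keep
    -- theirs, which is not this thread, since `Detects` is false before publication.
    refine ⟨_, _, G.publishE_trans hn hl hs hx h₂.1 h₁.1 h₄ hn₃ hlt,
      ⟨⟨h₁, ⟨h₄.1, n₃, hm, hs₃⟩, by simp, n₃, hm, hk⟩, h₂.ne, .setE_self hl,
        h₂.2.2.2.2.2.2.setE_ne h₂.ne.symm _⟩, fun S _ _ => ⟨fun _ => False.elim, id⟩⟩
  | aeUnlock₁ c e₁ e₂ n hn =>
    exact .of_trans (G.unlockE_trans hn (hL.2.2.1.get hn))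
      ⟨hL.1.setE hn rfl rfl, hL.2.2.2.setE_ne hL.2.1.symm _⟩ fun _ => id
  | aeUnlock₂ c e₂ n hn =>
    have hT := G.unlockE_trans hn (hL.2.get hn)
    exact .of_trans' hT (hL.1.setE hn rfl rfl) fun S _ hP _ hD =>
      ⟨hD, ⟨fun _ h => h.elim, .inr rfl⟩, fun h => h, fun τ hτ _ => (hP τ hτ).vReach hT.glob⟩
  | peVertexNext c R X x v n w hn hlt hw =>
    refine .of_read' G hL fun S _ hP ⟨h₁, h₂, h₃, h₄⟩ => ⟨h₁, h₂, h₃, fun τ hτ hx => ?_⟩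
    have hr := h₄ τ hτ hx
    obtain ⟨-, ⟨n', hn', hv, -⟩, -⟩ := hP τ hτ
    rw [Mem.vReach_eq] at hr ⊢
    -- The scan does not step past the vertex node of an arc from `x`: the node it leaves has a key
    -- below `x`.
    rcases hr.cases with rfl | ⟨z, hz, hr⟩
    · obtain rfl : n = n' := by simpa [hn] using hn'
      exact absurd (hv.trans hx) hlt.ne
    · obtain rfl : w = z := by simpa [Mem.vnx, hn, hw] using hz
      exact hr
  | peVertexAbsent c R X x v n hn hc =>
    refine .of_read' G hL fun S _ hP ⟨h₁, h₂, h₃, h₄⟩ => ?_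
    -- An arc of `S` from `x` would have its unmarked vertex node with key `x` at or beyond `v`,
    -- contrary to what the scan has read. So `x` counts as explored without any arc to follow.
    obtain ⟨h₅, h₆⟩ := h₂.insert fun τ hτ hx => by
      exfalso
      obtain ⟨-, ⟨n', hn', hv, hu⟩, -⟩ := hP τ hτ
      rcases (hP τ hτ).eq_of_vReach G hn (h₄ τ hτ hx) with rfl | h
      · obtain rfl : n = n' := by simpa [hn] using hn'
        rcases hc with hc | hc
        · exact hc.ne (hv.trans hx).symm
        · simp [hu] at hc
      · rw [hx] at h
        rcases hc with hc | hc
        · exact hc.asymm h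
        · exact h.ne hc.1
    exact ⟨h₁, h₅, h₆, h₃⟩
  | peVertexFound c R X x v n hn hv hu =>
    refine .of_read' G hL fun S _ hP ⟨h₁, h₂, h₃, h₄⟩ => ⟨h₁, h₂, fun τ hτ hx => .inl ?_⟩
    -- The node found is the vertex node of the arc, because nodes beyond it have larger keys. The
    -- unmarked edge node of the arc is then ahead in its list.
    rcases (hP τ hτ).eq_of_vReach G hn (h₄ τ hτ hx) with rfl | h
    · obtain ⟨-, -, h₅, n', h₆, -, h₇⟩ := hP τ hτ
      exact G.e_reach _ _ _ _ h₅ hn h₆ h₇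
    · exact absurd (hv.trans hx.symm) h.ne
  | peEdgeMore => exact .of_read G hL fun _ => id
  | peEdgeEnd c R X x e n hn hx =>
    refine .of_read' G hL fun S _ hP ⟨h₁, h₂, h₃⟩ => ⟨h₁, h₂, fun τ hτ h => ?_⟩
    refine (h₃ τ hτ h).resolve_left fun hr => ?_
    rw [Mem.eReach_eq] at hr
    rcases hr.cases with rfl | ⟨z, hz, -⟩
    -- The last node may be skipped: its key is `⊤`, so it is the edge node of no arc.
    · have := G.e_last _ _ _ (hP τ hτ).2.2.1 hn hx
      rw [((hP τ hτ).unmarked hn).1] at this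
      exact (Key.of_lt_top _).ne this
    · simp [Mem.enx, hn, hx] at hz
  | peStatusUnmarked c R X x e n hn hs =>
    refine .of_read' G hL fun S _ hP ⟨h₁, h₂, h₃⟩ =>
      ⟨h₁, h₂.mono (Set.subset_insert _ _), fun τ hτ hx => ?_⟩
    by_cases he : e = τ.e
    · subst he
      exact .inr (.inl ((hP τ hτ).unmarked hn).1.symm)
    · exact (h₃ τ hτ hx).imp (And.intro he) .inr
  | peStatusMarked c R X x e n hn hs =>
    refine .of_read' G hL fun S _ hP ⟨h₁, h₂, h₃⟩ => ⟨h₁, h₂, fun τ hτ hx => ?_⟩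
    refine (h₃ τ hτ hx).imp (And.intro ?_) id
    rintro rfl
    exact ((hP τ hτ).unmarked hn).2 hs
  | peNext c R X x e n w hn hw =>
    refine .of_read' G hL fun S _ hP ⟨h₁, h₂, h₃⟩ => ⟨h₁, h₂, fun τ hτ hx => ?_⟩
    refine (h₃ τ hτ hx).imp (fun ⟨hne, hr⟩ => ?_) id
    rw [Mem.eReach_eq] at hr ⊢
    rcases hr.cases with h | ⟨z, hz, hr⟩
    · exact absurd h hne
    · obtain rfl : w = z := by simpa [Mem.enx, hn, hw] using hz
      exact hr
  | peTestFound => exact .of_read G hL fun _ h => ⟨rfl, h.1⟩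
  | peTestNotFound c R X x hR =>
    refine .of_read G hL fun S ⟨h₁, h₂, h₃⟩ => ?_
    obtain ⟨h₅, h₆⟩ := h₂.insert h₃
    exact ⟨h₁, h₅, h₆, hR⟩
  | peLoopMore c R X x hx hx' =>
    exact .of_read' G hL fun S _ hP ⟨h₁, h₂, h₃, h₄⟩ =>
      ⟨h₁, ⟨h₂, .inl h₃⟩, h₄, fun τ hτ _ => (hP τ hτ).vReach G⟩
  | peLoopEnd c R X hR =>
    refine .of_read' G hL fun S hS hP ⟨h₁, h₂, h₃, h₄⟩ => ?_
    -- The set `S` leads from `k₂` back to `k₁`, so a closed exploration has put `k₁` into `R`,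
    -- where no test has found it.
    obtain ⟨τ, hτ, hu, hv⟩ := h₁.keys hL hP
    exact absurd (hu ▸ mem_of_explored hS h₂ hR hτ (hv ▸ h₃)) h₄
  | aeCommit c n hn =>
    exact .of_trans (G.commitE_trans hn hL.2.1 (by simp [hL.2.2.1])) trivial
      -- A detector leaves its search only with the answer true, so a committing thread detects no
      -- cyclic set that is present.
      fun _ h => Bool.noConfusion h.1
  | aeCycle => exact .of_read G hL fun _ h => h.2
  | aeUndo e₃ k₁ k₂ v₁ e₁ e₂ =>
    obtain ⟨hl, hW, hV₁, hV₂, hN⟩ := hL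
    obtain rfl := undo_eq G hl hW hV₁ hN
    obtain ⟨n, hn, hk⟩ := hl.2.2.2
    exact .of_read G ⟨rfl, hW.ne, hN, hV₂.eLk, ⟨n, hn, hk ▸ hl.1.2.2.2⟩,
      .inr ⟨rfl, hl.2.1⟩⟩ fun _ h => ⟨rfl, h⟩
  | rePresent k₁ k₂ v₁ e₁ e₂ n hn hk =>
    obtain ⟨hl, hW, hV₁, hV₂, hN⟩ := hL
    exact .of_read G ⟨rfl, hW.ne, hN, hV₂.eLk, ⟨n, hn, hk ▸ hl.1.2.2.2⟩, .inl ⟨rfl, hV₂⟩⟩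
      fun _ => False.elim
  | reAbsent =>
    exact .of_read G ⟨hL.2.1.ne, hL.2.2.1.eLk, hL.2.2.2.1.eLk⟩ fun _ => False.elim
  | reMark e₁ e₂ d b n hn =>
    obtain ⟨rfl, hne, hN, hl, hv, hd⟩ := hL
    have hl' := hl.get hn
    have hm : (m.setE d { n with status := .marked }).enode d =
        some { n with status := .marked } := by
      rw [Mem.setE_enode, if_pos rfl]
    refine .of_trans' (G.markE_trans hn hl' hd) ⟨hne, hN.setE_ne hne _,
      .setE_self hl', hv.setE hn rfl, ⟨_, hm, rfl⟩⟩ fun S _ hP _ h => ?_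
    -- The detector stops being one at the moment when marking its node destroys the presence of
    -- `S`.
    obtain ⟨-, τ, hτ, rfl⟩ := h
    exact ((hP τ hτ).unmarked hm).2 rfl
  | reRead e₁ e₂ b n hn =>
    exact .of_read G ⟨hL.1, hL.2.1, ⟨n, hn, hL.2.2.1.get hn, rfl⟩, hL.2.2.2⟩ fun _ => id
  | reUnlink e₁ e₂ w b n hn =>
    obtain ⟨hne, hN, ⟨n₂, hn₂, hl₂, rfl⟩, hv, hm⟩ := hL
    obtain ⟨hl, hx⟩ := hN.get hn
    exact .of_trans (G.unlinkE_trans hn hl hx hn₂ (hm.get hn₂) (hv.get hn₂))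
      ⟨hne, .setE_self hl, ELk.setE_ne ⟨n₂, hn₂, hl₂⟩ hne.symm _⟩ fun _ => id
  | eUnlock₁ e₁ e₂ b n hn =>
    exact .of_trans (G.unlockE_trans hn (hL.2.1.get hn)) (hL.2.2.setE_ne hL.1.symm _) fun _ => id
  | eUnlock₂ e₂ b n hn =>
    exact .of_trans (G.unlockE_trans hn (ELk.get hL hn)) trivial fun _ => id

end ConcGraph

/-! ### The initial state, executions and the conclusion -/

namespace ConcGraph

open PC Relation

variable {T K : Type*}

/-- The history of the initial state. -/
def initGhost (T : Type*) : Ghost T where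
  vp := {0, 1}
  own e := if e < 2 then some 0 else if e < 4 then some 1 else none
  vcr _ := none
  ecr _ := none

theorem initMem_vnode {σ : Status} {a : Addr} {n : VNode T K}
    (h : (initMem σ T K).vnode a = some n) :
    (a = 0 ∧ n = ⟨⊥, some 1, 0, 1, false, none⟩) ∨ (a = 1 ∧ n = ⟨⊤, none, 2, 3, false, none⟩) := by
  change (if a = 0 then some _ else if a = 1 then some _ else none) = some n at h
  split_ifs at h with h₀ h₁
  · exact .inl ⟨h₀, Option.some.inj h.symm⟩
  · exact .inr ⟨h₁, Option.some.inj h.symm⟩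

theorem initMem_enode {σ : Status} {a : Addr} {n : ENode T K}
    (h : (initMem σ T K).enode a = some n) :
    (a = 0 ∧ n = ⟨⊥, some 1, σ, none⟩) ∨ (a = 1 ∧ n = ⟨⊤, none, σ, none⟩) ∨
      (a = 2 ∧ n = ⟨⊥, some 3, σ, none⟩) ∨ (a = 3 ∧ n = ⟨⊤, none, σ, none⟩) := by
  simp only [initMem] at h
  split_ifs at h with h₀ h₁ h₂ h₃
  · exact .inl ⟨h₀, by simpa using h.symm⟩
  · exact .inr (.inl ⟨h₁, by simpa using h.symm⟩)
  · exact .inr (.inr (.inl ⟨h₂, by simpa using h.symm⟩))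
  · exact .inr (.inr (.inr ⟨h₃, by simpa using h.symm⟩))

variable [LinearOrder K]

/-- At every detecting program point the assertion of the thread says that its own node is in
transit, up to and including the point where it is about to be marked. So a cyclic set that has a
detector does not consist of added arcs only. -/
theorem Detects.exists_eMine {m : Mem T K} {g : Ghost T} {t : T} {S : Set (Arc K)} {p : PC K}
    (h : Detects m S p) (hL : Local m g t p) : ∃ τ ∈ S, EMine m g t τ.e := by
  have hc : ∀ e, HasE S e → EMine m g t e → ∃ τ ∈ S, EMine m g t τ.e := by
    rintro _ ⟨τ, hτ, rfl⟩ h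
    exact ⟨τ, hτ, h⟩
  have hm : ∀ mode k₁ k₂ v₁, ModeHas S mode → Loc m g t mode k₁ k₂ v₁ →
      ∃ τ ∈ S, EMine m g t τ.e := by
    intro mode k₁ k₂ v₁ h hL
    cases mode
    · exact h.elim
    · exact h.elim
    · exact hc _ h hL.2.1
  cases p
  case aeUnlock₁ => exact hc _ h hL.1.2.1
  case aeUnlock₂ => exact hc _ h hL.1.2.1
  case peVertex => exact hc _ h.1 hL.2.1
  case peEdge => exact hc _ h.1 hL.2.1
  case peStatus => exact hc _ h.1 hL.2.1
  case peNext => exact hc _ h.1 hL.2.1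
  case peTest => exact hc _ h.1 hL.2.1
  case peLoop => exact hc _ h.1 hL.2.1
  case peDone => exact hc _ h.2 hL.2.1
  case elStart => exact hm _ _ _ _ h hL
  case elScan => exact hm _ _ _ _ h hL.1
  case elLock₁ => exact hm _ _ _ _ h hL.1
  case elLock₂ => exact hm _ _ _ _ h hL.1
  case elCheck₁ => exact hm _ _ _ _ h hL.1
  case elCheck₂ => exact hm _ _ _ _ h hL.1
  case elCheck₃ => exact hm _ _ _ _ h hL.1
  case elFail₁ => exact hm _ _ _ _ h hL.1
  case elFail₂ => exact hm _ _ _ _ h hL.1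
  case elDone => exact hm _ _ _ _ h hL.1
  case reMark =>
    obtain ⟨rfl, -, -, -, -, ⟨hb, -⟩ | ⟨-, hd⟩⟩ := hL
    · simp [h.1] at hb
    · exact hc _ h.2 hd
  all_goals exact h.elim

/-- The invariant of the algorithm. -/
def Inv (s : State T K) : Prop :=
  ∃ g, Global s.mem g ∧ (∀ t, Local s.mem g t (s.pc t)) ∧
    ∀ S : Set (Arc K), S.Nonempty → Cyclic S → (∀ τ ∈ S, Present s.mem g τ) →
      ∃ t, Detects s.mem S (s.pc t)

/-- The acting thread is handled by `ThreadStep.outcome`; all others are covered by `Rely.stable`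
for their assertions and by `Keeps.detects` for their role as detectors. -/
theorem Inv.step [DecidableEq T] {σ : Status} {s s' : State T K} (h : Inv s) (hs : Step σ s s') :
    Inv s' := by
  obtain ⟨t, m', p', hs⟩ := hs
  obtain ⟨g, G, hL, hC⟩ := h
  obtain ⟨g', N, hT, hL', hD⟩ := hs.outcome G (hL t)
  refine ⟨g', hT.glob, fun t' => ?_, fun S hne hS hP => ?_⟩
  · by_cases ht : t' = t
    · subst ht
      simpa using hL'
    · simpa [Function.update_of_ne ht] using (hT.rely t' ht).stable G _ (hL t')
  · obtain ⟨hD₁, hD₂⟩ := hD S hS hP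
    -- Either this step completes `S` and its thread takes over, or `S` was already present and its
    -- old detector is still one.
    by_cases hN : ∃ τ ∈ S, τ.e ∈ N
    · exact ⟨t, by simpa using hD₂ hN⟩
    · have hP' : ∀ τ ∈ S, Present s.mem g τ := fun τ hτ =>
        (hT.back τ (hP τ hτ)).resolve_right fun h => hN ⟨τ, hτ, h⟩
      obtain ⟨t', ht'⟩ := hC S hne hS hP'
      refine ⟨t', ?_⟩
      by_cases ht : t' = t
      · subst ht
        simpa using hD₁ hP' ht'
      · simpa [Function.update_of_ne ht] using hT.keep.detects hP _ ht'

theorem global_init (σ : Status) : Global (initMem σ T K) (initGhost T) where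
  v_alloc a h := by
    rcases h with rfl | rfl
    · exact ⟨_, rfl⟩
    · exact ⟨_, rfl⟩
  v_head := .inl rfl
  v_bot := ⟨_, rfl, rfl⟩
  v_next a n b h hb := by
    rcases initMem_vnode h with ⟨rfl, rfl⟩ | ⟨rfl, rfl⟩
    · obtain rfl : 1 = b := by simpa using hb
      exact ⟨.inr rfl, _, rfl, bot_lt_top⟩
    · simp at hb
  v_reach a n _ h _ := by
    rcases initMem_vnode h with ⟨rfl, rfl⟩ | ⟨rfl, rfl⟩
    · exact ReflTransGen.refl
    · exact ReflTransGen.single ⟨_, rfl, rfl⟩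
  v_lock a n t h hl := by
    rcases initMem_vnode h with ⟨rfl, rfl⟩ | ⟨rfl, rfl⟩ <;> simp at hl
  v_cr a t h := by simp [initGhost] at h
  v_edge a n h := by
    rcases initMem_vnode h with ⟨rfl, rfl⟩ | ⟨rfl, rfl⟩
    · exact ⟨rfl, _, rfl, rfl⟩
    · exact ⟨rfl, _, rfl, rfl⟩
  e_alloc e w h := by
    simp only [initGhost] at h
    split_ifs at h with h₁ h₂
    · obtain rfl : 0 = w := by simpa using h
      refine ⟨?_, _, rfl⟩
      interval_cases e <;> exact ⟨_, rfl⟩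
    · obtain rfl : 1 = w := by simpa using h
      refine ⟨?_, _, rfl⟩
      interval_cases e
      · exact ⟨_, rfl⟩
      · exact ⟨_, rfl⟩
  e_next e n f h hf := by
    rcases initMem_enode h with ⟨rfl, rfl⟩ | ⟨rfl, rfl⟩ | ⟨rfl, rfl⟩ | ⟨rfl, rfl⟩
    · obtain rfl : 1 = f := by simpa using hf
      exact ⟨_, rfl, bot_lt_top⟩
    · simp at hf
    · obtain rfl : 3 = f := by simpa using hf
      exact ⟨_, rfl, bot_lt_top⟩
    · simp at hf
  e_own e n f w ho h hf := by
    rcases initMem_enode h with ⟨rfl, rfl⟩ | ⟨rfl, rfl⟩ | ⟨rfl, rfl⟩ | ⟨rfl, rfl⟩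
    · obtain rfl : 1 = f := by simpa using hf
      exact ho
    · simp at hf
    · obtain rfl : 3 = f := by simpa using hf
      exact ho
    · simp at hf
  e_last e n w _ h hf := by
    rcases initMem_enode h with ⟨rfl, rfl⟩ | ⟨rfl, rfl⟩ | ⟨rfl, rfl⟩ | ⟨rfl, rfl⟩
    · simp at hf
    · rfl
    · simp at hf
    · rfl
  e_reach e n w v ho hv h _ := by
    rcases initMem_enode h with ⟨rfl, rfl⟩ | ⟨rfl, rfl⟩ | ⟨rfl, rfl⟩ | ⟨rfl, rfl⟩ <;>
    rcases initMem_vnode hv with ⟨rfl, rfl⟩ | ⟨rfl, rfl⟩ <;>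
    simp [initGhost] at ho
    · exact ReflTransGen.refl
    · exact ReflTransGen.single ⟨_, rfl, rfl⟩
    · exact ReflTransGen.refl
    · exact ReflTransGen.single ⟨_, rfl, rfl⟩
  e_lock e n t h hl := by
    rcases initMem_enode h with ⟨rfl, rfl⟩ | ⟨rfl, rfl⟩ | ⟨rfl, rfl⟩ | ⟨rfl, rfl⟩ <;> simp at hl
  e_cr e t h := by simp [initGhost] at h

/-- All initial edge nodes are sentinels with keys `⊥` or `⊤`, so no arc is present. -/
theorem inv_init (σ : Status) : Inv (initState σ T K) := by
  refine ⟨initGhost T, global_init σ, fun _ => trivial, fun S ⟨τ, hτ⟩ _ hP => ?_⟩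
  obtain ⟨-, -, -, n, h₁, h₂, -⟩ := hP τ hτ
  rcases initMem_enode h₁ with ⟨-, rfl⟩ | ⟨-, rfl⟩ | ⟨-, rfl⟩ | ⟨-, rfl⟩
  · exact absurd h₂ (Key.bot_lt_of _).ne
  · exact absurd h₂ (Key.of_lt_top _).ne'
  · exact absurd h₂ (Key.bot_lt_of _).ne
  · exact absurd h₂ (Key.of_lt_top _).ne'

theorem Inv.acyclic {s : State T K} (h : Inv s) : Acyclic s.mem.AddedEdge := by
  obtain ⟨g, G, hL, hC⟩ := h
  set r := s.mem.AddedEdge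
  -- All added arcs whose edge lies on a cycle of added edges. This is a cyclic set, nonempty as
  -- soon as there is one cycle, and it has no node in transit.
  set S : Set (Arc K) := {τ | Present s.mem g τ ∧ r τ.u τ.v ∧ ReflTransGen r τ.v τ.u ∧
    ∃ n, s.mem.enode τ.e = some n ∧ n.status = .added}
  have harc : ∀ u v, r u v → ReflTransGen r v u → ∃ τ ∈ S, τ.u = u ∧ τ.v = v := by
    intro u v huv hvu
    obtain ⟨n, ⟨w, hw, hn, hu, hm⟩, -, e, ne, he, hne, hv, ha⟩ := id huv
    refine ⟨⟨u, w, e, v⟩, ⟨⟨G.vReach_vp hw G.v_head, ⟨n, hn, hu, hm⟩, ?_, ne, hne, hv, by simp [ha]⟩,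
      huv, hvu, ne, hne, ha⟩, rfl, rfl⟩
    exact G.eReach_own he (G.v_edge _ _ hn).1
  have hS : Cyclic S := by
    intro τ hτ
    -- The walk from `τ.v` to `y` is carried along so that each further edge from `y` to `z` is
    -- again on a cycle: from `z` to `τ.u`, along `τ`, and on to `y`.
    have key : ∀ y, ReflTransGen r y τ.u → ReflTransGen r τ.v y →
        ReflTransGen (ArcRel S) (Key.of y) (Key.of τ.u) := by
      intro y hy
      induction hy using ReflTransGen.head_induction_on with
      | refl => exact fun _ => ReflTransGen.refl
      | @head y z hyz hz ih =>
        intro hvy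
        obtain ⟨τ', hτ', rfl, rfl⟩ := harc y z hyz (hz.trans (.head hτ.2.1 hvy))
        exact .head ⟨τ', hτ', rfl, rfl⟩ (ih (hvy.tail hyz))
    exact key _ hτ.2.2.1 .refl
  intro u hu
  obtain ⟨v, huv, hvu⟩ := TransGen.head'_iff.1 hu
  obtain ⟨τ, hτ, -⟩ := harc u v huv hvu
  obtain ⟨t, ht⟩ := hC S ⟨τ, hτ⟩ hS fun τ hτ => hτ.1
  obtain ⟨τ', hτ', -, n, hn, hs⟩ := ht.exists_eMine (hL t)
  obtain ⟨-, -, -, n', hn', hs'⟩ := hτ'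
  obtain rfl : n = n' := by simpa [hn] using hn'
  simp [hs] at hs'

theorem IsExecution.inv [DecidableEq T] {σ : Status} {s : ℕ → State T K} (hs : IsExecution σ s)
    (i : ℕ) : Inv (s i) := by
  induction i with
  | zero => exact hs.1 ▸ inv_init σ
  | succ i ih =>
    rcases hs.2 i with h | h
    · exact ih.step h
    · exact h ▸ ih

end ConcGraph
theorem mainTheorem2 {T K : Type*} [DecidableEq T] [LinearOrder K]
    (σ : ConcGraph.Status) (hσ : σ ≠ ConcGraph.Status.marked)
    (s : ℕ → ConcGraph.State T K) (hs : ConcGraph.IsExecution σ s) (i : ℕ) :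
    ConcGraph.Acyclic (s i).mem.AddedEdge :=
  (hs.inv i).acyclic
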